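/- Let $n\ge 2$, $\alpha>0$, $T>0$, $\Omega=(0,1)^n$, let $x_0\in(0,1)$ be a real algebraic number of degree greater than one over $\mathbb{Q}$, and let $\omega_\alpha=\{i^{-\alpha}: i=1,2,3,\dots\}$. Put $$\omega=\Omega\cap\bigl(\{x_0\}\times\underbrace{\omega_\alpha\times\cdots\times\omega_\alpha}_{n-1}\bigr)$$ (the intersection with $\Omega$ only discards the points having a coordinate equal to $1$, which lie on $\partial\Omega$). Then $\omega$ is countable, and the heat equation $$\partial_t u-\Delta u=0 \ \text{ in } (0,T)\times\Omega,\qquad u=0\ \text{ on } (0,T)\times\partial\Omega,\qquad u(0,\cdot)=u_0\ \text{ in }\Omega$$ is observable from $\omega$ at time $T$: there is a constant $C=C(n,\alpha,x_0,T)>0$ such that for every real-valued $u_0\in L^2(\Omega)$ the weak solution $u\in L^2(0,T;H^1_0(\Omega))\cap H^1(0,T;H^{-1}(\Omega))\subset C([0,T];L^2(\Omega))$, taken with its representative that is continuous on $(0,T]\times\Omega$, satisfies $$\|u(T,\cdot)\|_{L^\infty(\Omega)}\le C\int_0^T\sup_{x\in\omega}|u(t,x)|\,dt ,$$ where the right-hand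 side is allowed to be $+\infty$. -/

import Mathlib

/-- `φ` is a test function on the set `Ω`: smooth, with compact support contained in `Ω`. -/
def IsTestFunction {E : Type*} [NormedAddCommGroup E] [NormedSpace ℝ E]
    (Ω : Set E) (φ : E → ℝ) : Prop :=
  ContDiff ℝ ((⊤ : ℕ∞) : WithTop ℕ∞) φ ∧ HasCompactSupport φ ∧ tsupport φ ⊆ Ω

/-- `g` is the weak (distributional) gradient of `f` in `Ω`. -/
def HasWeakGradient {n : ℕ} (Ω : Set (EuclideanSpace ℝ (Fin n)))
    (f : EuclideanSpace ℝ (Fin n) → ℝ)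
    (g : EuclideanSpace ℝ (Fin n) → EuclideanSpace ℝ (Fin n)) : Prop :=
  ∀ φ : EuclideanSpace ℝ (Fin n) → ℝ, IsTestFunction Ω φ →
    ∫ x in Ω, f x • gradient φ x = - ∫ x in Ω, φ x • g x

/-- `f` belongs to `H₀¹(Ω)` and `g` is its weak gradient: `f` and `g` are in `L²(Ω)`, and `f` is
the limit in the `H¹(Ω)` norm of a sequence of test functions on `Ω`. -/
def IsH01WithGradient {n : ℕ} (Ω : Set (EuclideanSpace ℝ (Fin n)))
    (f : EuclideanSpace ℝ (Fin n) → ℝ)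
    (g : EuclideanSpace ℝ (Fin n) → EuclideanSpace ℝ (Fin n)) : Prop :=
  MeasureTheory.MemLp f 2 (MeasureTheory.volume.restrict Ω) ∧
  MeasureTheory.MemLp g 2 (MeasureTheory.volume.restrict Ω) ∧
  HasWeakGradient Ω f g ∧
  ∃ ψ : ℕ → EuclideanSpace ℝ (Fin n) → ℝ,
    (∀ j, IsTestFunction Ω (ψ j)) ∧
    Filter.Tendsto
      (fun j => MeasureTheory.eLpNorm (fun x => ψ j x - f x) 2
        (MeasureTheory.volume.restrict Ω))
      Filter.atTop (nhds 0) ∧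
    Filter.Tendsto
      (fun j => MeasureTheory.eLpNorm (fun x => gradient (ψ j) x - g x) 2
        (MeasureTheory.volume.restrict Ω))
      Filter.atTop (nhds 0)

/-- `u` is the weak solution on `(0,T) × Ω` of the heat equation `∂ₜ u - Δ u = 0` with homogeneous
Dirichlet boundary conditions and initial datum `u₀`, taken with its pointwise representative,
continuous on `(0,T] × Ω`.

The equation `∂ₜ u = Δ u` in `L²(0,T; H⁻¹(Ω))` is the statement that for each `v ∈ H₀¹(Ω)` the
function `t ↦ ∫_Ω u(t) v` has the weak derivative `t ↦ - ∫_Ω ∇u(t) · ∇v` on `(0,T)`. -/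
structure IsHeatSolution {n : ℕ} (Ω : Set (EuclideanSpace ℝ (Fin n))) (T : ℝ)
    (u₀ : EuclideanSpace ℝ (Fin n) → ℝ) (u : ℝ → EuclideanSpace ℝ (Fin n) → ℝ) : Prop where
  /-- `u ∈ C([0,T]; L²(Ω))`: values in `L²(Ω)`. -/
  memLp : ∀ t ∈ Set.Icc 0 T, MeasureTheory.MemLp (u t) 2 (MeasureTheory.volume.restrict Ω)
  /-- `u ∈ C([0,T]; L²(Ω))`: continuity. -/
  continuous_L2 : ∀ t ∈ Set.Icc 0 T,
    Filter.Tendsto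
      (fun s => MeasureTheory.eLpNorm (fun x => u s x - u t x) 2
        (MeasureTheory.volume.restrict Ω))
      (nhdsWithin t (Set.Icc 0 T)) (nhds 0)
  /-- `u(0,·) = u₀` in `L²(Ω)`. -/
  initial : u 0 =ᵐ[MeasureTheory.volume.restrict Ω] u₀
  /-- `u ∈ L²(0,T; H₀¹(Ω))`, and the equation holds in `H⁻¹(Ω)`. -/
  weak_equation : ∃ g : ℝ → EuclideanSpace ℝ (Fin n) → EuclideanSpace ℝ (Fin n),
    MeasureTheory.MemLp (fun p : ℝ × EuclideanSpace ℝ (Fin n) => u p.1 p.2) 2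
      ((MeasureTheory.volume.restrict (Set.Ioo 0 T)).prod
        (MeasureTheory.volume.restrict Ω)) ∧
    MeasureTheory.MemLp (fun p : ℝ × EuclideanSpace ℝ (Fin n) => g p.1 p.2) 2
      ((MeasureTheory.volume.restrict (Set.Ioo 0 T)).prod
        (MeasureTheory.volume.restrict Ω)) ∧
    (∀ᵐ t ∂(MeasureTheory.volume.restrict (Set.Ioo 0 T)), IsH01WithGradient Ω (u t) (g t)) ∧
    ∀ (v : EuclideanSpace ℝ (Fin n) → ℝ)
      (w : EuclideanSpace ℝ (Fin n) → EuclideanSpace ℝ (Fin n)), IsH01WithGradient Ω v w →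
      ∀ η : ℝ → ℝ, IsTestFunction (Set.Ioo 0 T) η →
        ∫ t in Set.Ioo 0 T, (∫ x in Ω, u t x * v x) * deriv η t =
          ∫ t in Set.Ioo 0 T, (∫ x in Ω, inner ℝ (g t x) (w x)) * η t
  /-- The pointwise values of `u` are those of the continuous representative. -/
  continuousOn : ContinuousOn (fun p : ℝ × EuclideanSpace ℝ (Fin n) => u p.1 p.2)
    (Set.Ioc 0 T ×ˢ Ω)

/-- The heat equation on `Ω` is observable from `ω` (a measurable subset of `Ω`) at time `T`:
`‖u(T,·)‖_{L^∞(Ω)} ≤ C ∫₀ᵀ sup_{x ∈ ω} |u(t,x)| dt` with `C` independent of the datum. The right-hand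
side may be infinite. -/
def HeatObservable {n : ℕ} (Ω ω : Set (EuclideanSpace ℝ (Fin n))) (T : ℝ) : Prop :=
  ∃ C : ℝ, 0 < C ∧
    ∀ u₀ : EuclideanSpace ℝ (Fin n) → ℝ,
      MeasureTheory.MemLp u₀ 2 (MeasureTheory.volume.restrict Ω) →
      ∀ u : ℝ → EuclideanSpace ℝ (Fin n) → ℝ, IsHeatSolution Ω T u₀ u →
        MeasureTheory.eLpNorm (u T) ⊤ (MeasureTheory.volume.restrict Ω) ≤
          ENNReal.ofReal C * ∫⁻ t in Set.Ioo 0 T, ⨆ x ∈ ω, ‖u t x‖ₑ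

/-- The open unit cube `(0,1)ⁿ`. -/
def openUnitCube (n : ℕ) : Set (EuclideanSpace ℝ (Fin n)) :=
  {x | ∀ i, x i ∈ Set.Ioo (0 : ℝ) 1}

/-- `ω_α = {i^{-α} : i = 1, 2, …}`. -/
def omegaAlpha (α : ℝ) : Set ℝ :=
  {y | ∃ i : ℕ, 1 ≤ i ∧ y = (i : ℝ) ^ (-α)}

/-- The set `{x₀} × ω_α × ⋯ × ω_α` in `ℝⁿ`, with `n - 1` factors `ω_α`. -/
def pointTimesOmegaAlpha (n : ℕ) (x₀ α : ℝ) : Set (EuclideanSpace ℝ (Fin n)) :=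
  {x | ∀ i : Fin n, x i ∈ if (i : ℕ) = 0 then {x₀} else omegaAlpha α}

/-! On the cube the solution is a sine series with coefficients decaying like exp(-λ_κ t), λ_κ =
π²|κ|². The proof has an analytic half, observability of such series from the nodes, and a
functional-analytic half, the fact that every weak solution is such a series.

The analytic half isolates one mode κ with all κ_i ≤ N from finitely many space-time values. In the
coordinates carrying i^(-α), the functions sin(πly), 1 ≤ l ≤ N, equal sin(πy) times polynomials of
degree < N in cos(πy), so N distinct nodes determine them by Lagrange interpolation
(`exists_sine_dual`). The nodes are only polynomially close (`exists_cos_separation`), which makes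
the weights at most exp(O(N log N)). In the remaining coordinate there is a single point x₀; once
the other frequencies are fixed, the eigenvalues differ only through π²l², and these are separated
by sampling at N equispaced times (`exists_exp_dual`). What survives is the mode times
sin(πκ_{i₀}x₀), and Liouville's inequality (`exists_le_abs_sin_of_isAlgebraic`) bounds this factor
below by a power of 1/κ_{i₀}. `exists_mode_dual` and `low_mode_le` combine these.

The high modes are treated as an error and absorbed by the Lebeau-Robbiano method on the windows
[2^(-r), 2·2^(-r)] with N = 4^r. Isolating low modes costs exp(O(4^r r)) (`exists_cost_bound`),
whereas dissipation of the high ones gains exp(-8^r/4), which wins for large r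
(`exists_cost_mul_damping_le`). Passing from scale r+1 to scale r then halves the unknown part of
the estimate, and iterating from arbitrarily small times removes it:
`exists_heatSeries_observability`.

For the other half, the sines belong to H₀¹ and may be used as test functions, so each coefficient
of a weak solution satisfies a scalar linear equation weakly (`IsHeatSolution.coeff_eq`).
Completeness of the sines (`ae_eq_zero_of_integral_mul_sineFun_eq_zero`) then gives
`IsHeatSolution.eq_heatSeries`, pointwise in the open cube. -/

/-! ### Dual weights for sines and for decaying exponentials -/

open Real in
theorem integral_sin_mul_sin (k l : ℕ) (hk : k ≠ 0) :
    ∫ x in (0:ℝ)..1, sin (π * k * x) * sin (π * l * x) = if k = l then 1 / 2 else 0 := by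
  have key : ∀ m : ℤ, m ≠ 0 → ∫ x in (0:ℝ)..1, cos (π * m * x) = 0 := by
    intro m hm
    have hne : π * (m : ℝ) ≠ 0 := mul_ne_zero pi_ne_zero (by exact_mod_cast hm)
    rw [intervalIntegral.integral_comp_mul_left (fun y => cos y) hne, integral_cos]
    simp [mul_comm π, sin_int_mul_pi]
  have e : ∀ x : ℝ, sin (π * k * x) * sin (π * l * x) =
      (1/2) * (cos (π * ((k - l : ℤ) : ℝ) * x) - cos (π * ((k + l : ℤ) : ℝ) * x)) := by
    intro x
    have h1 : π * ((k - l : ℤ) : ℝ) * x = π * k * x - π * l * x := by push_cast; ring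
    have h2 : π * ((k + l : ℤ) : ℝ) * x = π * k * x + π * l * x := by push_cast; ring
    rw [h1, h2, cos_sub, cos_add]; ring
  simp_rw [e]
  rw [intervalIntegral.integral_const_mul, intervalIntegral.integral_sub
    (Continuous.intervalIntegrable (by fun_prop) _ _)
    (Continuous.intervalIntegrable (by fun_prop) _ _), key (k + l : ℤ) (by omega)]
  split_ifs with h
  · subst h; simp
  · rw [key (k - l : ℤ) (by omega)]; simp

/-- A monic product of linear factors with roots in `[-1, 1]` has small coefficients. -/
theorem exists_coeff_prod_sub {ι : Type*} (J : Finset ι) (z : ι → ℝ)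
    (hz : ∀ j ∈ J, |z j| ≤ 1) :
    ∃ c : ℕ → ℝ, (∀ N, J.card < N → ∀ x : ℝ,
        ∑ m ∈ Finset.range N, c m * x ^ m = ∏ j ∈ J, (x - z j)) ∧
      (∀ N, ∑ m ∈ Finset.range N, |c m| ≤ 2 ^ J.card) := by
  classical
  induction J using Finset.induction_on with
  | empty =>
    refine ⟨fun m => if m = 0 then 1 else 0, ?_, ?_⟩
    · intro N hN x
      have : 0 < N := by simpa using hN
      simp [this]
    · intro N
      have : ∀ m : ℕ, |(if m = 0 then (1:ℝ) else 0)| = if m = 0 then 1 else 0 := by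
        intro m; split_ifs <;> simp
      simp_rw [this]
      rw [Finset.sum_ite_eq']
      split_ifs <;> simp
  | insert j J hj ih =>
    obtain ⟨c, h1, h2⟩ := ih (fun i hi => hz i (Finset.mem_insert_of_mem hi))
    have hzj := hz j (Finset.mem_insert_self _ _)
    -- Multiplication by X - z_j: the shifted coefficients minus z_j times the old ones. As |z_j| ≤
    -- 1, the ℓ¹ norm at most doubles.
    refine ⟨fun m => (if m = 0 then 0 else c (m - 1)) - z j * c m, ?_, ?_⟩
    · intro N hN x
      rw [Finset.card_insert_of_notMem hj] at hN
      obtain ⟨M, rfl⟩ : ∃ M, N = M + 1 := ⟨N - 1, by omega⟩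
      rw [Finset.prod_insert hj, ← h1 (M + 1) (by omega) x]
      simp_rw [sub_mul]
      rw [Finset.sum_sub_distrib, Finset.sum_range_succ']
      simp only [Nat.succ_ne_zero, if_false, Nat.add_sub_cancel, if_true, zero_mul, add_zero]
      congr 1
      · rw [h1 (M + 1) (by omega) x, ← h1 M (by omega) x, Finset.mul_sum]
        exact Finset.sum_congr rfl fun i _ => by ring
      · rw [Finset.mul_sum]
        exact Finset.sum_congr rfl fun i _ => by ring
    · intro N
      rw [Finset.card_insert_of_notMem hj]
      calc ∑ m ∈ Finset.range N, |(if m = 0 then 0 else c (m - 1)) - z j * c m|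
          ≤ ∑ m ∈ Finset.range N, (|if m = 0 then 0 else c (m - 1)| + |c m|) := by
            refine Finset.sum_le_sum fun m _ => (abs_sub _ _).trans ?_
            refine add_le_add le_rfl ?_
            rw [abs_mul]
            exact mul_le_of_le_one_left (abs_nonneg _) hzj
        _ ≤ 2 ^ J.card + 2 ^ J.card := by
            rw [Finset.sum_add_distrib]
            refine add_le_add ?_ (h2 N)
            rcases N with _ | M
            · simp
            · rw [Finset.sum_range_succ']
              simpa using h2 M
        _ = 2 ^ (J.card + 1) := by ring

open Real Polynomial in
/-- Biorthogonal weights for the first sines, supported on prescribed nodes. -/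
theorem exists_sine_dual (N : ℕ) (x : Fin N → ℝ) (δ : ℝ) (hδ : 0 < δ)
    (hsep : ∀ i j, i ≠ j → δ ≤ |cos (π * x i) - cos (π * x j)|)
    (hsin : ∀ i, δ ≤ sin (π * x i)) (k : ℕ) (hk : k ≠ 0) :
    ∃ L : Fin N → ℝ, (∀ l ≤ N, ∑ i, L i * sin (π * l * x i) = if k = l then 1 else 0) ∧
      ∀ i, |L i| ≤ 2 * (2 / δ) ^ N := by
  have hinj : Set.InjOn (fun i => cos (π * x i)) ((Finset.univ : Finset (Fin N)) : Set (Fin N)) := by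
    intro i _ j _ hij
    by_contra hne
    have := hsep i j hne
    simp only at hij
    rw [hij, sub_self, abs_zero] at this
    linarith
  set ℓ : Fin N → ℝ[X] := fun i => Lagrange.basis Finset.univ (fun i => cos (π * x i)) i with hℓ
  have hcont : ∀ i, Continuous fun y : ℝ => (ℓ i).eval (cos (π * y)) := fun i =>
    (ℓ i).continuous.comp (by fun_prop)
  -- The weight at a node is the k-th sine coefficient of the function multiplying the value at that
  -- node in the interpolation formula; the 2 normalizes ∫ sin² = 1/2.
  refine ⟨fun i => 2 * (∫ y in (0:ℝ)..1, (ℓ i).eval (cos (π * y)) * sin (π * y) * sin (π * k * y))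
    / sin (π * x i), ?_, ?_⟩
  · intro l hl
    -- Interpolation in the variable cos(πy) is exact here: sin(πly) / sin(πy) is the Chebyshev
    -- polynomial U of degree l - 1 < N.
    have hexp : ∀ y : ℝ, sin (π * l * y) =
        ∑ i, (ℓ i).eval (cos (π * y)) * sin (π * y) * (sin (π * l * x i) / sin (π * x i)) := by
      intro y
      rcases Nat.eq_zero_or_pos l with rfl | hl0
      · simp
      obtain ⟨m, rfl⟩ : ∃ m, l = m + 1 := ⟨l - 1, by omega⟩
      have hU : ∀ θ : ℝ, sin (π * ((m + 1 : ℕ) : ℝ) * θ) =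
          (Chebyshev.U ℝ m).eval (cos (π * θ)) * sin (π * θ) := by
        intro θ
        have := Chebyshev.U_real_cos (π * θ) (m : ℤ)
        rw [this]; congr 1; push_cast; ring
      have hint := Lagrange.eq_interpolate (f := Chebyshev.U ℝ m) (s := Finset.univ) hinj (by
        rw [Chebyshev.degree_U_natCast, Finset.card_univ, Fintype.card_fin]
        exact_mod_cast hl)
      rw [hU y, hint, Lagrange.interpolate_apply, eval_finsetSum, Finset.sum_mul]
      refine Finset.sum_congr rfl fun i _ => ?_
      have : sin (π * x i) ≠ 0 := (hδ.trans_le (hsin i)).ne'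
      rw [hU (x i), eval_mul, eval_C]
      field_simp
      simp only [hℓ]
      ring
    have h2 := integral_sin_mul_sin k l hk
    have h3 : ∫ y in (0:ℝ)..1, sin (π * k * y) * sin (π * l * y) =
        ∑ i, (∫ y in (0:ℝ)..1, (ℓ i).eval (cos (π * y)) * sin (π * y) * sin (π * k * y)) *
          (sin (π * l * x i) / sin (π * x i)) := by
      simp_rw [← intervalIntegral.integral_mul_const]
      rw [← intervalIntegral.integral_finsetSum]
      · refine intervalIntegral.integral_congr fun y _ => ?_
        rw [hexp y, Finset.mul_sum]
        exact Finset.sum_congr rfl fun i _ => by ring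
      · intro i _
        refine Continuous.intervalIntegrable ?_ _ _
        have := hcont i
        fun_prop
    rw [h2] at h3
    have h4 : (if k = l then (1:ℝ) else 0) = 2 * (if k = l then 1 / 2 else 0) := by
      split_ifs <;> norm_num
    rw [h4, h3, Finset.mul_sum]
    exact Finset.sum_congr rfl fun i _ => by ring
  · intro i
    have hs := hsin i
    have hs0 := hδ.trans_le hs
    have hN : 0 < N := i.pos
    have hb : ∀ y : ℝ, |(ℓ i).eval (cos (π * y))| ≤ (2 / δ) ^ (N - 1) := by
      intro y
      rw [hℓ]
      simp only [Lagrange.basis, eval_prod, Finset.abs_prod]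
      have hc : (Finset.univ.erase i : Finset (Fin N)).card = N - 1 := by
        rw [Finset.card_erase_of_mem (Finset.mem_univ _), Finset.card_univ, Fintype.card_fin]
      rw [← hc, ← Finset.prod_const]
      refine Finset.prod_le_prod (fun _ _ => abs_nonneg _) fun j hj => ?_
      have hij := hsep i j (Finset.ne_of_mem_erase hj).symm
      simp only [Lagrange.basisDivisor, eval_mul, eval_C, eval_sub, eval_X, abs_mul, abs_inv]
      have h1 : |cos (π * y) - cos (π * x j)| ≤ 2 := by
        refine (abs_sub _ _).trans ?_
        linarith [abs_cos_le_one (π * y), abs_cos_le_one (π * x j)]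
      rw [inv_mul_eq_div]
      gcongr
    have hI : |∫ y in (0:ℝ)..1, (ℓ i).eval (cos (π * y)) * sin (π * y) * sin (π * k * y)| ≤
        (2 / δ) ^ (N - 1) := by
      have := intervalIntegral.norm_integral_le_of_norm_le_const (a := (0:ℝ)) (b := 1)
        (C := (2 / δ) ^ (N - 1))
        (f := fun y => (ℓ i).eval (cos (π * y)) * sin (π * y) * sin (π * k * y)) (by
          intro y _
          rw [norm_mul, norm_mul, Real.norm_eq_abs, Real.norm_eq_abs, Real.norm_eq_abs]
          calc _ ≤ (2 / δ) ^ (N - 1) * 1 * 1 := by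
                gcongr
                · exact hb y
                · exact abs_sin_le_one _
                · exact abs_sin_le_one _
            _ = _ := by ring)
      simpa using this
    rw [abs_div, abs_mul, abs_of_pos hs0, abs_two]
    calc _ ≤ 2 * (2 / δ) ^ (N - 1) / δ := by gcongr
      _ ≤ 2 * (2 / δ) ^ N := by
        obtain ⟨m, rfl⟩ : ∃ m, N = m + 1 := ⟨N - 1, by omega⟩
        rw [Nat.add_sub_cancel, pow_succ]
        have : 0 < (2 / δ) ^ m := by positivity
        rw [div_eq_mul_inv, div_eq_mul_inv 2 δ] at *
        have : 0 < δ⁻¹ := by positivity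
        nlinarith [mul_pos ‹0 < (2 * δ⁻¹) ^ m› this]

open Real in
/-- Biorthogonal weights for the exponentials `exp (-π² l² t)`, `1 ≤ l ≤ N`, on equispaced times. -/
theorem exists_exp_dual (N k : ℕ) (hk : 1 ≤ k) (hkN : k ≤ N) (h : ℝ) (hh : 0 < h) :
    ∃ c : ℕ → ℝ, (∀ l, 1 ≤ l → l ≤ N →
        ∑ m ∈ Finset.range N, c m * exp (-(π ^ 2 * l ^ 2 * h)) ^ m = if k = l then 1 else 0) ∧
      (∑ m ∈ Finset.range N, |c m|) * exp (-(π ^ 2 * k ^ 2 * h)) ^ N ≤ (2 * (1 + 1 / h)) ^ N := by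
  set z : ℕ → ℝ := fun l => exp (-(π ^ 2 * l ^ 2 * h)) with hz
  have hz0 : ∀ l, 0 < z l := fun l => exp_pos _
  have hz1 : ∀ l, z l ≤ 1 := fun l => by
    rw [hz]; simp only [exp_le_one_iff, Left.neg_nonpos_iff]; positivity
  -- The gap is measured relative to z_p: the exponents differ by at least h, and exp(-h) ≤ 1/(1+h).
  have hgap : ∀ p q : ℕ, p < q → z p * (h / (1 + h)) ≤ z p - z q := by
    intro p q hpq
    have hq : z q = z p * exp (-(π ^ 2 * (q ^ 2 - p ^ 2) * h)) := by
      simp only [hz]; rw [← exp_add]; congr 1; ring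
    have hpq' : (p:ℝ) + 1 ≤ q := by exact_mod_cast hpq
    have hp0 : (0:ℝ) ≤ p := p.cast_nonneg
    have h1 : (1:ℝ) ≤ π ^ 2 * (q ^ 2 - p ^ 2) := by
      have : (1:ℝ) ≤ q ^ 2 - p ^ 2 := by nlinarith
      have : (1:ℝ) ≤ π ^ 2 := by nlinarith [pi_gt_three]
      nlinarith
    have h2 : exp (-(π ^ 2 * (q ^ 2 - p ^ 2) * h)) ≤ 1 / (1 + h) := by
      rw [exp_neg, ← one_div]
      apply one_div_le_one_div_of_le (by positivity)
      nlinarith [add_one_le_exp (π ^ 2 * ((q:ℝ) ^ 2 - p ^ 2) * h)]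
    rw [hq]
    have : h / (1 + h) = 1 - 1 / (1 + h) := by field_simp; ring
    rw [this]
    nlinarith [hz0 p]
  set J := (Finset.Icc 1 N).erase k with hJ
  have hkI : k ∈ Finset.Icc 1 N := Finset.mem_Icc.2 ⟨hk, hkN⟩
  have hJc : J.card = N - 1 := by
    rw [hJ, Finset.card_erase_of_mem hkI]; simp
  obtain ⟨c, hc1, hc2⟩ := exists_coeff_prod_sub J z (fun j _ => by
    rw [abs_of_pos (hz0 j)]; exact hz1 j)
  set P := ∏ j ∈ J, (z k - z j) with hP
  set g := z k * (h / (1 + h)) with hg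
  have hg0 : 0 < g := mul_pos (hz0 k) (by positivity)
  have hPb : g ^ (N - 1) ≤ |P| := by
    rw [hP, Finset.abs_prod, ← hJc, ← Finset.prod_const]
    refine Finset.prod_le_prod (fun _ _ => hg0.le) fun j hj => ?_
    rcases lt_or_gt_of_ne (Finset.ne_of_mem_erase hj) with hlt | hlt
    · have h1 := hgap j k hlt
      have h2 : z k ≤ z j := by
        have : 0 ≤ z j * (h / (1 + h)) := mul_nonneg (hz0 j).le (by positivity)
        linarith
      rw [abs_sub_comm]
      refine le_trans ?_ (h1.trans (le_abs_self _))
      rw [hg]; gcongr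
    · exact (hgap k j hlt).trans (le_abs_self _)
  have hP0 : P ≠ 0 := by
    intro h0; rw [h0, abs_zero] at hPb
    exact absurd hPb (not_le.2 (by positivity))
  -- Coefficients of the Lagrange basis polynomial at z_k for the nodes z_1, …, z_N.
  refine ⟨fun m => c m / P, ?_, ?_⟩
  · intro l hl hlN
    have := hc1 N (by omega) (z l)
    simp_rw [div_mul_eq_mul_div]
    rw [← Finset.sum_div, this]
    split_ifs with hkl
    · subst hkl; exact div_self hP0
    · rw [Finset.prod_eq_zero (i := l) _ (sub_self _), zero_div]
      exact Finset.mem_erase.2 ⟨Ne.symm hkl, Finset.mem_Icc.2 ⟨hl, hlN⟩⟩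
  · simp_rw [abs_div]
    rw [← Finset.sum_div]
    change _ / |P| * z k ^ N ≤ _
    obtain ⟨M, rfl⟩ : ∃ M, N = M + 1 := ⟨N - 1, by omega⟩
    simp only [Nat.add_sub_cancel] at hPb hJc
    have hX : (1:ℝ) ≤ 2 * (1 + 1 / h) := by
      have : 0 < 1 / h := by positivity
      linarith
    -- The denominator may be as small as z_k^(N-1); the factor z_k^N in the statement pays for
    -- exactly this and leaves a bound free of k.
    calc (∑ m ∈ Finset.range (M + 1), |c m|) / |P| * z k ^ (M + 1)
        ≤ 2 ^ M / g ^ M * z k ^ M := by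
          have h2 := hc2 (M + 1)
          rw [hJc] at h2
          have h3 : z k ^ (M + 1) ≤ z k ^ M := pow_le_pow_of_le_one (hz0 k).le (hz1 k) (Nat.le_succ _)
          have : 0 ≤ z k ^ (M + 1) := pow_nonneg (hz0 k).le _
          gcongr
      _ = (2 * (1 + 1 / h)) ^ M := by
          rw [← div_pow, ← mul_pow]
          congr 1
          have := (hz0 k).ne'
          rw [hg]
          field_simp
          ring
      _ ≤ _ := pow_le_pow_right₀ hX (Nat.le_succ _)

/-! ### Quantitative separation: the nodes i^(-α) and the point x₀ -/

-- Jordan's inequality, applied at θ or at 1 - θ according to which is smaller.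
open Real in
theorem two_mul_min_le_sin_pi_mul {θ : ℝ} (h0 : 0 ≤ θ) (h1 : θ ≤ 1) :
    2 * min θ (1 - θ) ≤ sin (π * θ) := by
  rcases le_total θ (1 / 2) with h | h
  · have := mul_le_sin (x := π * θ) (by positivity) (by nlinarith [pi_pos])
    rw [← mul_assoc, div_mul_cancel₀ _ pi_ne_zero] at this
    exact (mul_le_mul_of_nonneg_left (min_le_left _ _) (by norm_num)).trans this
  · have := mul_le_sin (x := π * (1 - θ)) (mul_nonneg pi_pos.le (by linarith))
      (by nlinarith [pi_pos])
    rw [← mul_assoc, div_mul_cancel₀ _ pi_ne_zero] at this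
    have e : sin (π * (1 - θ)) = sin (π * θ) := by rw [mul_sub, mul_one, sin_pi_sub]
    rw [e] at this
    exact (mul_le_mul_of_nonneg_left (min_le_right _ _) (by norm_num)).trans this

-- Writes p^(-α) as q^(-α) exp(α log(q/p)), then uses exp x ≥ 1 + x and log(q/p) ≥ 1 - p/q ≥ 1/q.
open Real in
theorem rpow_neg_sub_rpow_neg_ge {α : ℝ} (hα : 0 < α) {p q : ℕ} (hp : 1 ≤ p) (hpq : p < q) :
    α * (q:ℝ) ^ (-α) / q ≤ (p:ℝ) ^ (-α) - (q:ℝ) ^ (-α) := by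
  have hp0 : (0:ℝ) < p := by exact_mod_cast hp
  have hq0 : (0:ℝ) < q := by exact_mod_cast (hp.trans hpq.le)
  have hpq' : (p:ℝ) + 1 ≤ q := by exact_mod_cast hpq
  have e : (p:ℝ) ^ (-α) = (q:ℝ) ^ (-α) * exp (α * log (q / p)) := by
    rw [rpow_def_of_pos hp0, rpow_def_of_pos hq0, ← exp_add, log_div hq0.ne' hp0.ne']
    congr 1; ring
  have h1 := add_one_le_exp (α * log (q / p))
  have h2 := one_sub_inv_le_log_of_pos (div_pos hq0 hp0)
  rw [inv_div] at h2
  have h3 : 1 / (q:ℝ) ≤ 1 - p / q := by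
    rw [div_le_iff₀ hq0, sub_mul, div_mul_cancel₀ _ hq0.ne']; linarith
  have h4 : α * (1 / q) ≤ α * log (q / p) := by gcongr; linarith
  have hq1 : 0 < (q:ℝ) ^ (-α) := by positivity
  rw [e]
  have : α * (q:ℝ) ^ (-α) / q = (q:ℝ) ^ (-α) * (α * (1 / q)) := by ring
  rw [this]
  nlinarith

open Real in
/-- Polynomial separation of the images under `cos (π ·)` of the points `i ^ (-α)`. -/
theorem exists_cos_separation {α : ℝ} (hα : 0 < α) :
    ∃ c : ℝ, 0 < c ∧ c ≤ 1 ∧ ∃ B : ℕ, ∀ N : ℕ,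
      (∀ i j : Fin N, i ≠ j → c / (N + 1) ^ B ≤
        |cos (π * ((i + 2 : ℕ) : ℝ) ^ (-α)) - cos (π * ((j + 2 : ℕ) : ℝ) ^ (-α))|) ∧
      ∀ i : Fin N, c / (N + 1) ^ B ≤ sin (π * ((i + 2 : ℕ) : ℝ) ^ (-α)) := by
  set e := min α 1 with he
  have he0 : 0 < e := lt_min hα one_pos
  have he1 : e ≤ 1 := min_le_right _ _
  set b := ⌈α⌉₊ with hb
  -- A difference of cosines is twice a product of two sines, each at least `D`, the common lower
  -- bound for the gaps between nodes and for their distances to 0 and 1. Hence the square.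
  refine ⟨e ^ 2, by positivity, pow_le_one₀ he0.le he1, 2 * (b + 1), fun N => ?_⟩
  set D := e / ((N:ℝ) + 1) ^ (b + 1) with hD
  have hN1 : (1:ℝ) ≤ (N:ℝ) + 1 := by linarith [N.cast_nonneg (α := ℝ)]
  have hD0 : 0 < D := by positivity
  have hD1 : D ≤ 1 := by
    rw [hD]; exact div_le_one_of_le₀ (he1.trans (one_le_pow₀ hN1)) (by positivity)
  have hDD : e ^ 2 / ((N:ℝ) + 1) ^ (2 * (b + 1)) = D ^ 2 := by
    rw [hD, div_pow, ← pow_mul, mul_comm 2]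
  rw [hDD]
  have hlow : ∀ q : ℕ, 1 ≤ q → q ≤ N + 1 → 1 / ((N:ℝ) + 1) ^ b ≤ (q:ℝ) ^ (-α) := by
    intro q hq hqN
    have hq1 : (1:ℝ) ≤ q := by exact_mod_cast hq
    have hqN' : (q:ℝ) ≤ N + 1 := by exact_mod_cast hqN
    rw [rpow_neg (by linarith), ← one_div]
    apply one_div_le_one_div_of_le (by positivity)
    calc (q:ℝ) ^ α ≤ (q:ℝ) ^ (b:ℝ) := rpow_le_rpow_of_exponent_le hq1 (Nat.le_ceil _)
      _ = (q:ℝ) ^ b := rpow_natCast _ _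
      _ ≤ _ := by gcongr
  have hdiff : ∀ p q : ℕ, 1 ≤ p → p < q → q ≤ N + 1 → D ≤ (p:ℝ) ^ (-α) - (q:ℝ) ^ (-α) := by
    intro p q hp hpq hq
    refine le_trans ?_ (rpow_neg_sub_rpow_neg_ge hα hp hpq)
    have hq0 : (0:ℝ) < q := by exact_mod_cast (hp.trans hpq.le)
    have hqN' : (q:ℝ) ≤ N + 1 := by exact_mod_cast hq
    have h1 := hlow q (by omega) hq
    have e1 : D = e * (1 / ((N:ℝ) + 1) ^ b) / (N + 1) := by rw [hD, pow_succ]; field_simp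
    rw [e1]
    have : e ≤ α := min_le_left _ _
    gcongr
  -- The endpoint 1 is itself the power with index 1, so the gap estimate covers it. Nodes start at
  -- index 2 because all sines vanish at 1.
  have hx1 : ∀ q : ℕ, 2 ≤ q → q ≤ N + 1 → D ≤ 1 - (q:ℝ) ^ (-α) := by
    intro q hq hqN
    simpa using hdiff 1 q le_rfl (by omega) hqN
  have hx0 : ∀ q : ℕ, 2 ≤ q → q ≤ N + 1 → D ≤ (q:ℝ) ^ (-α) := by
    intro q hq hqN
    refine le_trans ?_ (hlow q (by omega) hqN)
    rw [hD]
    gcongr; first | exact he1 | omega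
  constructor
  · have main : ∀ p q : ℕ, 2 ≤ p → p < q → q ≤ N + 1 →
        D ^ 2 ≤ |cos (π * (p:ℝ) ^ (-α)) - cos (π * (q:ℝ) ^ (-α))| := by
      intro p q hp hpq hq
      set x := (p:ℝ) ^ (-α)
      set y := (q:ℝ) ^ (-α)
      have h1 := hdiff p q (by omega) hpq hq
      have h2 := hx1 p hp (by omega)
      have h3 := hx0 q (by omega) hq
      rw [cos_sub_cos]
      have e1 : (π * x + π * y) / 2 = π * ((x + y) / 2) := by ring
      have e2 : (π * x - π * y) / 2 = π * ((x - y) / 2) := by ring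
      rw [e1, e2]
      have s1 := two_mul_min_le_sin_pi_mul (θ := (x + y) / 2) (by linarith) (by linarith)
      have s2 := two_mul_min_le_sin_pi_mul (θ := (x - y) / 2) (by linarith) (by linarith)
      have m1 : D / 2 ≤ min ((x + y) / 2) (1 - (x + y) / 2) := le_min (by linarith) (by linarith)
      have m2 : D / 2 ≤ min ((x - y) / 2) (1 - (x - y) / 2) := le_min (by linarith) (by linarith)
      have t1 : D ≤ sin (π * ((x + y) / 2)) := by linarith
      have t2 : D ≤ sin (π * ((x - y) / 2)) := by linarith
      rw [abs_mul, abs_mul, abs_of_pos (hD0.trans_le t1), abs_of_pos (hD0.trans_le t2)]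
      norm_num
      nlinarith
    intro i j hij
    have hi := i.2
    have hj := j.2
    rcases lt_or_gt_of_ne (fun h => hij (Fin.ext h) : (i:ℕ) ≠ j) with h | h
    · exact main _ _ (by omega) (by omega) (by omega)
    · rw [abs_sub_comm]
      exact main _ _ (by omega) (by omega) (by omega)
  · intro i
    have hi := i.2
    have h1 := hx0 (i + 2) (by omega) (by omega)
    have h2 := hx1 (i + 2) (by omega) (by omega)
    have s1 := two_mul_min_le_sin_pi_mul (θ := ((i + 2 : ℕ) : ℝ) ^ (-α)) (by linarith) (by linarith)
    have m1 : D ≤ min (((i + 2 : ℕ) : ℝ) ^ (-α)) (1 - ((i + 2 : ℕ) : ℝ) ^ (-α)) := le_min h1 h2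
    nlinarith

open Real in
/-- Liouville's inequality for `sin (π k x₀)` at an irrational algebraic number `x₀`. -/
theorem exists_le_abs_sin_of_isAlgebraic {x₀ : ℝ} (halg : IsAlgebraic ℚ x₀)
    (hdeg : 1 < (minpoly ℚ x₀).natDegree) :
    ∃ c : ℝ, 0 < c ∧ ∃ d : ℕ, ∀ k : ℕ, 1 ≤ k → c / k ^ d ≤ |sin (π * k * x₀)| := by
  have hirr : Irrational x₀ := by
    rintro ⟨q, rfl⟩
    have : minpoly ℚ ((q:ℚ):ℝ) = Polynomial.X - Polynomial.C q := minpoly.eq_X_sub_C ℝ q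
    rw [this, Polynomial.natDegree_X_sub_C] at hdeg
    omega
  obtain ⟨f, f0, fa⟩ := (IsFractionRing.isAlgebraic_iff ℤ ℚ ℝ).2 halg
  obtain ⟨A, hA, hL⟩ := Liouville.exists_pos_real_of_irrational_root hirr f0
    (by rwa [Polynomial.eval_map_algebraMap])
  refine ⟨2 / A, by positivity, f.natDegree, fun k hk => ?_⟩
  have hk0 : (0:ℝ) < k := by exact_mod_cast hk
  have hk1 : (1:ℝ) ≤ k := by exact_mod_cast hk
  set a := round (k * x₀) with ha
  -- Liouville's inequality is stated for denominators of the form b + 1. The numerator is the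
  -- integer nearest to k x₀, so that |sin(πkx₀)| is at least twice the distance from k x₀ to it.
  have h1 := hL a (k - 1)
  have e1 : (((k - 1 : ℕ) : ℝ) + 1) = k := by
    rw [Nat.cast_sub hk]; simp
  rw [e1] at h1
  set y := |k * x₀ - a| with hy
  have hy2 : y ≤ 1 / 2 := abs_sub_round _
  have hy0 : 0 ≤ y := abs_nonneg _
  have e2 : |x₀ - a / k| = y / k := by
    rw [hy, ← abs_of_pos hk0, ← abs_div, abs_of_pos hk0]
    congr 1; field_simp
  rw [e2] at h1
  have h2 : 1 ≤ (k:ℝ) ^ f.natDegree * (y * A) := by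
    refine h1.trans ?_
    have : y / k ≤ y := div_le_self hy0 hk1
    gcongr
  have h3 : |sin (π * k * x₀)| = |sin (π * y)| := by
    have : |sin (π * (k * x₀ - a))| = |sin (π * k * x₀)| := by
      rw [mul_sub, mul_comm π (a:ℝ), sin_sub_int_mul_pi, ← mul_assoc, abs_mul]
      simp [abs_zpow]
    rw [← this, hy]
    rcases abs_choice (k * x₀ - a) with h | h <;> rw [h]
    rw [mul_neg, sin_neg, abs_neg]
  rw [h3]
  have h4 := two_mul_min_le_sin_pi_mul hy0 (by linarith)
  rw [min_eq_left (by linarith)] at h4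
  refine le_trans ?_ (h4.trans (le_abs_self _))
  rw [div_div, div_le_iff₀ (by positivity)]
  nlinarith

/-! ### Isolating one mode from space-time samples -/

/-- The eigenfunction `∏ sin (π κ_i x_i)` of the Dirichlet Laplacian of the unit cube. -/
noncomputable def sineMode {n : ℕ} (κ : Fin n → ℕ) (x : Fin n → ℝ) : ℝ :=
  ∏ i, Real.sin (Real.pi * κ i * x i)

/-- The eigenvalue `π² |κ|²` of `sineMode κ`. -/
noncomputable def sineFreq {n : ℕ} (κ : Fin n → ℕ) : ℝ :=
  Real.pi ^ 2 * ∑ i, (κ i : ℝ) ^ 2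

theorem sineFreq_nonneg {n : ℕ} (κ : Fin n → ℕ) : 0 ≤ sineFreq κ := by
  unfold sineFreq; positivity

theorem abs_sineMode_le {n : ℕ} (κ : Fin n → ℕ) (x : Fin n → ℝ) : |sineMode κ x| ≤ 1 := by
  unfold sineMode
  rw [Finset.abs_prod]
  exact Finset.prod_le_one (fun _ _ => abs_nonneg _) fun _ _ => Real.abs_sin_le_one _

theorem sineMode_eq_zero {n : ℕ} {κ : Fin n → ℕ} (h : ∃ i, κ i = 0) (x : Fin n → ℝ) :
    sineMode κ x = 0 := by
  obtain ⟨i, hi⟩ := h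
  exact Finset.prod_eq_zero (Finset.mem_univ i) (by simp [hi])

/-- The observation nodes: `x₀` in the coordinate `i₀`, powers in the other coordinates. -/
noncomputable def obsNode {n : ℕ} (i₀ : Fin n) (x₀ α : ℝ) {N : ℕ} (p : Fin n → Fin N) :
    Fin n → ℝ :=
  fun i => if i = i₀ then x₀ else ((p i + 2 : ℕ) : ℝ) ^ (-α)

open Real in
/-- A finite combination of space-time point values which isolates one low mode. -/
theorem exists_mode_dual {n : ℕ} (i₀ : Fin n) (x₀ α : ℝ) (N : ℕ)
    (δ : ℝ) (hδ : 0 < δ) (hδ1 : δ ≤ 1)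
    (hsep : ∀ i j : Fin N, i ≠ j → δ ≤
        |cos (π * ((i + 2 : ℕ) : ℝ) ^ (-α)) - cos (π * ((j + 2 : ℕ) : ℝ) ^ (-α))|)
    (hsin : ∀ i : Fin N, δ ≤ sin (π * ((i + 2 : ℕ) : ℝ) ^ (-α)))
    (κ : Fin n → ℕ) (hκ : ∀ i, 1 ≤ κ i) (hκN : ∀ i, κ i ≤ N) (h : ℝ) (hh : 0 < h) :
    ∃ C : ℕ → (Fin n → Fin N) → ℝ,
      (∀ l : Fin n → ℕ, (∀ i, l i ≤ N) → ∀ t : ℝ,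
        ∑ m ∈ Finset.range N, ∑ p : Fin n → Fin N,
          C m p * (exp (-(sineFreq l * (t + m * h))) * sineMode l (obsNode i₀ x₀ α p)) =
        if l = κ then exp (-(sineFreq κ * (t + N * h))) * sin (π * κ i₀ * x₀) else 0) ∧
      ∑ m ∈ Finset.range N, ∑ p : Fin n → Fin N, |C m p| ≤
        (2 * (1 + 1 / h)) ^ N * (N * (2 * (2 / δ) ^ N)) ^ n := by
  have hN : 0 < N := (hκ i₀).trans (hκN i₀)
  have hN0 : (0:ℝ) < N := by exact_mod_cast hN
  have hX : ∀ i : Fin n, ∃ w : Fin N → ℝ,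
      (∀ l ≤ N, ∑ p, w p * sin (π * l * (if i = i₀ then x₀ else ((p + 2 : ℕ) : ℝ) ^ (-α))) =
        if i = i₀ then sin (π * l * x₀) else if κ i = l then 1 else 0) ∧
      ∀ p, |w p| ≤ 2 * (2 / δ) ^ N := by
    intro i
    by_cases hi : i = i₀
    -- The node does not depend on the index in the direction i₀, so that index is just averaged
    -- out.
    · refine ⟨fun _ => 1 / N, fun l _ => ?_, fun p => ?_⟩
      · simp only [hi, if_true]
        rw [Finset.sum_const, Finset.card_univ, Fintype.card_fin, nsmul_eq_mul]
        field_simp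
      · have h1 : (1:ℝ) / N ≤ 1 := div_le_one_of_le₀ (by exact_mod_cast hN) hN0.le
        have h2 : (1:ℝ) ≤ 2 / δ := by rw [le_div_iff₀ hδ]; linarith
        have h3 : (1:ℝ) ≤ (2 / δ) ^ N := one_le_pow₀ h2
        rw [abs_of_pos (by positivity)]
        linarith
    · simp only [hi, if_false]
      exact exists_sine_dual N (fun p => ((p + 2 : ℕ) : ℝ) ^ (-α)) δ hδ hsep hsin (κ i)
        (by have := hκ i; omega)
  choose w hw1 hw2 using hX
  obtain ⟨c, hc1, hc2⟩ := exists_exp_dual N (κ i₀) (hκ i₀) (hκN i₀) h hh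
  -- The part of the eigenvalue coming from the directions other than i₀. It is shared by all modes
  -- which survive the spatial weights.
  set ρ := sineFreq κ - π ^ 2 * (κ i₀ : ℝ) ^ 2 with hρ
  have hsplit : ∀ l : Fin n → ℕ, sineFreq l = π ^ 2 * (l i₀ : ℝ) ^ 2 +
      π ^ 2 * ∑ i ∈ Finset.univ.erase i₀, (l i : ℝ) ^ 2 := by
    intro l
    rw [sineFreq, ← Finset.add_sum_erase _ _ (Finset.mem_univ i₀), mul_add]
  have hρ0 : 0 ≤ ρ := by rw [hρ, hsplit κ]; rw [add_sub_cancel_left]; positivity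
  -- The factor exp(ρmh) removes the common decay, leaving the one-dimensional exponentials to which
  -- `c` is dual. The factor exp(-λ_κ N h) moves the output to time t + Nh and keeps the weights
  -- bounded, by the second claim of `exists_exp_dual`.
  refine ⟨fun m p => c m * exp (ρ * (m * h)) * exp (-(sineFreq κ * (N * h))) * ∏ i, w i (p i),
    ?_, ?_⟩
  · intro l hl t
    have hprod : ∑ p : Fin n → Fin N, (∏ i, w i (p i)) * sineMode l (obsNode i₀ x₀ α p) =
        ∏ i, (if i = i₀ then sin (π * l i * x₀) else if κ i = l i then 1 else 0) := by
      rw [← Finset.prod_congr rfl fun i _ => hw1 i (l i) (hl i), Finset.prod_univ_sum,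
        Fintype.piFinset_univ]
      refine Finset.sum_congr rfl fun p _ => ?_
      rw [sineMode, ← Finset.prod_mul_distrib]
      rfl
    have hfac : ∑ m ∈ Finset.range N, ∑ p : Fin n → Fin N,
          (c m * exp (ρ * (m * h)) * exp (-(sineFreq κ * (N * h))) * ∏ i, w i (p i)) *
          (exp (-(sineFreq l * (t + m * h))) * sineMode l (obsNode i₀ x₀ α p)) =
        (∑ m ∈ Finset.range N, c m * exp (ρ * (m * h)) * exp (-(sineFreq κ * (N * h))) *
          exp (-(sineFreq l * (t + m * h)))) *
        ∏ i, (if i = i₀ then sin (π * l i * x₀) else if κ i = l i then 1 else 0) := by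
      rw [← hprod, Finset.sum_mul_sum]
      exact Finset.sum_congr rfl fun m _ => Finset.sum_congr rfl fun p _ => by ring
    rw [hfac]
    by_cases hoff : ∃ i, i ≠ i₀ ∧ κ i ≠ l i
    · obtain ⟨i, hi, hil⟩ := hoff
      rw [Finset.prod_eq_zero (Finset.mem_univ i) (by simp [hi, hil]), mul_zero,
        if_neg (fun hlk => hil (by rw [hlk]))]
    push Not at hoff
    have hP : ∏ i, (if i = i₀ then sin (π * l i * x₀) else if κ i = l i then 1 else 0) =
        sin (π * l i₀ * x₀) := by
      rw [Finset.prod_eq_single i₀]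
      · simp
      · intro i _ hi; simp [hi, hoff i hi]
      · simp
    have hfl : sineFreq l = ρ + π ^ 2 * (l i₀ : ℝ) ^ 2 := by
      rw [hρ, hsplit l, hsplit κ, Finset.sum_congr rfl fun i hi => by
        rw [← hoff i (Finset.ne_of_mem_erase hi)]]
      ring
    have hlk : l = κ ↔ κ i₀ = l i₀ := by
      constructor
      · rintro rfl; rfl
      · intro h0; funext i
        by_cases hi : i = i₀
        · rw [hi, h0]
        · exact (hoff i hi).symm
    rw [hP]
    -- The time weights say nothing about frequency 0, but there the factor sin(πl_{i₀}x₀) vanishes.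
    rcases Nat.eq_zero_or_pos (l i₀) with h0 | h0
    · rw [if_neg (fun hl => by have := hlk.1 hl; have := hκ i₀; omega), h0]
      simp
    have hsum : ∑ m ∈ Finset.range N, c m * exp (ρ * (m * h)) *
        exp (-(sineFreq κ * (N * h))) * exp (-(sineFreq l * (t + m * h))) =
        exp (-(sineFreq κ * (N * h))) * exp (-(sineFreq l * t)) *
          ∑ m ∈ Finset.range N, c m * exp (-(π ^ 2 * (l i₀ : ℝ) ^ 2 * h)) ^ m := by
      rw [Finset.mul_sum]
      refine Finset.sum_congr rfl fun m _ => ?_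
      rw [← exp_nat_mul]
      have : exp (ρ * (m * h)) * exp (-(sineFreq l * (t + m * h))) =
          exp (-(sineFreq l * t)) * exp ((m:ℝ) * -(π ^ 2 * (l i₀ : ℝ) ^ 2 * h)) := by
        rw [← exp_add, ← exp_add, hfl]; congr 1; ring
      linear_combination (c m * exp (-(sineFreq κ * (N * h)))) * this
    rw [hsum, hc1 (l i₀) h0 (hl i₀)]
    by_cases hk : κ i₀ = l i₀
    · rw [if_pos hk, if_pos (hlk.2 hk), hlk.2 hk, mul_one, ← exp_add]
      congr 2; ring
    · rw [if_neg hk, if_neg (fun hl => hk (hlk.1 hl))]; ring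
  · have habs : ∀ (m : ℕ) (p : Fin n → Fin N),
        |c m * exp (ρ * (m * h)) * exp (-(sineFreq κ * (N * h))) * ∏ i, w i (p i)| =
        (|c m| * (exp (ρ * (m * h)) * exp (-(sineFreq κ * (N * h))))) * ∏ i, |w i (p i)| := by
      intro m p
      rw [abs_mul, abs_mul, abs_mul, abs_exp, abs_exp, Finset.abs_prod]; ring
    simp_rw [habs]
    rw [← Finset.sum_mul_sum]
    have h1 : ∑ p : Fin n → Fin N, ∏ i, |w i (p i)| ≤ (N * (2 * (2 / δ) ^ N)) ^ n := by
      have : ∑ p : Fin n → Fin N, ∏ i, |w i (p i)| = ∏ i, ∑ q, |w i q| := by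
        rw [Finset.prod_univ_sum, Fintype.piFinset_univ]
      rw [this]
      calc ∏ i, ∑ q, |w i q| ≤ ∏ _i : Fin n, (N * (2 * (2 / δ) ^ N)) := by
            refine Finset.prod_le_prod (fun i _ => Finset.sum_nonneg fun _ _ => abs_nonneg _)
              fun i _ => ?_
            refine (Finset.sum_le_sum fun q _ => hw2 i q).trans ?_
            simp
        _ = _ := by simp
    have h2 : ∑ m ∈ Finset.range N, |c m| * (exp (ρ * (m * h)) * exp (-(sineFreq κ * (N * h)))) ≤
        (2 * (1 + 1 / h)) ^ N := by
      refine le_trans ?_ hc2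
      rw [Finset.sum_mul]
      refine Finset.sum_le_sum fun m hm => ?_
      gcongr
      rw [← exp_add, ← exp_nat_mul]
      apply exp_le_exp.2
      have hmN : (m:ℝ) ≤ N := by exact_mod_cast (Finset.mem_range.1 hm).le
      have : sineFreq κ = ρ + π ^ 2 * (κ i₀ : ℝ) ^ 2 := by rw [hρ]; ring
      rw [this]
      nlinarith [mul_le_mul_of_nonneg_left hmN (mul_nonneg hρ0 hh.le)]
    refine mul_le_mul h2 h1 ?_ (by positivity)
    exact Finset.sum_nonneg fun _ _ => Finset.prod_nonneg fun _ _ => abs_nonneg _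

/-! ### Convergence and tails of the sine series -/

-- Since λ_κ ≥ Σ κ_i, the sum is dominated by a product of n geometric series of ratio exp(-σ), each
-- at most 1 + 1/σ.
open Real in
theorem summable_exp_sineFreq (n : ℕ) {σ : ℝ} (hσ : 0 < σ) :
    Summable (fun κ : Fin n → ℕ => exp (-(sineFreq κ * σ))) ∧
      ∑' κ : Fin n → ℕ, exp (-(sineFreq κ * σ)) ≤ (1 + 1 / σ) ^ n := by
  have hbound : ∀ s : Finset (Fin n → ℕ), ∑ κ ∈ s, exp (-(sineFreq κ * σ)) ≤ (1 + 1 / σ) ^ n := by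
    intro s
    obtain ⟨R, hR⟩ : ∃ R : ℕ, s ⊆ Fintype.piFinset fun _ => Finset.range R := by
      refine ⟨(s.sup fun κ => Finset.univ.sup κ) + 1, fun κ hκ => ?_⟩
      rw [Fintype.mem_piFinset]
      intro i
      rw [Finset.mem_range, Nat.lt_succ_iff]
      exact (Finset.le_sup (f := κ) (Finset.mem_univ i)).trans
        (Finset.le_sup (f := fun κ : Fin n → ℕ => Finset.univ.sup κ) hκ)
    have hterm : ∀ κ : Fin n → ℕ, exp (-(sineFreq κ * σ)) ≤ ∏ i, exp (-σ) ^ κ i := by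
      intro κ
      simp_rw [← exp_nat_mul]
      rw [← exp_sum]
      apply exp_le_exp.2
      rw [sineFreq, ← Finset.sum_mul]
      have h1 : ∑ i, (κ i : ℝ) ≤ π ^ 2 * ∑ i, (κ i : ℝ) ^ 2 := by
        rw [Finset.mul_sum]
        refine Finset.sum_le_sum fun i _ => ?_
        have h2 : (κ i : ℝ) ≤ (κ i : ℝ) ^ 2 := by exact_mod_cast Nat.le_self_pow two_ne_zero _
        have h3 : (1:ℝ) ≤ π ^ 2 := by nlinarith [pi_gt_three]
        nlinarith [sq_nonneg (κ i : ℝ)]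
      nlinarith
    have hr : exp (-σ) < 1 := by simpa using hσ
    calc _ ≤ ∑ κ ∈ Fintype.piFinset fun _ : Fin n => Finset.range R, exp (-(sineFreq κ * σ)) :=
          Finset.sum_le_sum_of_subset_of_nonneg hR fun _ _ _ => (exp_pos _).le
      _ ≤ ∑ κ ∈ Fintype.piFinset fun _ : Fin n => Finset.range R, ∏ i, exp (-σ) ^ κ i :=
          Finset.sum_le_sum fun κ _ => hterm κ
      _ = (∑ m ∈ Finset.range R, exp (-σ) ^ m) ^ n := by
          rw [← Finset.prod_univ_sum]; simp
      _ ≤ (1 + 1 / σ) ^ n := by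
          have h0 : 0 ≤ ∑ m ∈ Finset.range R, exp (-σ) ^ m :=
            Finset.sum_nonneg fun _ _ => pow_nonneg (exp_pos _).le _
          refine pow_le_pow_left₀ h0 ?_ n
          have hg := summable_geometric_of_lt_one (exp_pos (-σ)).le hr
          refine (hg.sum_le_tsum _ fun _ _ => pow_nonneg (exp_pos _).le _).trans ?_
          rw [tsum_geometric_of_lt_one (exp_pos (-σ)).le hr]
          have h1 : exp (-σ) ≤ 1 / (1 + σ) := by
            rw [exp_neg, ← one_div]
            exact one_div_le_one_div_of_le (by positivity) (by linarith [add_one_le_exp σ])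
          have h2 : σ / (1 + σ) ≤ 1 - exp (-σ) := by
            have : σ / (1 + σ) = 1 - 1 / (1 + σ) := by field_simp; ring
            linarith
          rw [← one_div]
          refine (one_div_le_one_div_of_le (by positivity) h2).trans (le_of_eq ?_)
          field_simp
          ring
  exact ⟨summable_of_sum_le (fun _ => (exp_pos _).le) hbound,
    Real.tsum_le_of_sum_le (fun _ => (exp_pos _).le) hbound⟩

/-- The solution of the heat equation with sine coefficients `a`. -/
noncomputable def heatSeries {n : ℕ} (a : (Fin n → ℕ) → ℝ) (t : ℝ) (x : Fin n → ℝ) : ℝ :=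
  ∑' κ, a κ * (Real.exp (-(sineFreq κ * t)) * sineMode κ x)

-- The size of the solution at time s is recorded by `S`, a supremum of coefficients rather than an
-- L² norm; all later estimates propagate this quantity.
open Real in
theorem norm_heatSeries_term_le {n : ℕ} {a : (Fin n → ℕ) → ℝ} {s S : ℝ}
    (hS : ∀ κ, |a κ| * exp (-(sineFreq κ * s)) ≤ S) (t : ℝ) (x : Fin n → ℝ) (κ : Fin n → ℕ) :
    ‖a κ * (exp (-(sineFreq κ * t)) * sineMode κ x)‖ ≤ S * exp (-(sineFreq κ * (t - s))) := by
  rw [Real.norm_eq_abs, abs_mul, abs_mul, abs_exp]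
  have e : exp (-(sineFreq κ * t)) = exp (-(sineFreq κ * s)) * exp (-(sineFreq κ * (t - s))) := by
    rw [← exp_add]; congr 1; ring
  calc |a κ| * (exp (-(sineFreq κ * t)) * |sineMode κ x|)
      ≤ |a κ| * (exp (-(sineFreq κ * t)) * 1) := by
        gcongr; exact abs_sineMode_le κ x
    _ = |a κ| * exp (-(sineFreq κ * s)) * exp (-(sineFreq κ * (t - s))) := by rw [e]; ring
    _ ≤ _ := by gcongr; exact hS κ

open Real in
theorem summable_heatSeries {n : ℕ} {a : (Fin n → ℕ) → ℝ} {s S : ℝ}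
    (hS : ∀ κ, |a κ| * exp (-(sineFreq κ * s)) ≤ S) {t : ℝ} (ht : s < t) (x : Fin n → ℝ) :
    Summable fun κ => a κ * (exp (-(sineFreq κ * t)) * sineMode κ x) :=
  Summable.of_norm_bounded ((summable_exp_sineFreq n (sub_pos.2 ht)).1.mul_left S)
    (norm_heatSeries_term_le hS t x)

open Real in
theorem abs_heatSeries_le {n : ℕ} {a : (Fin n → ℕ) → ℝ} {s S : ℝ}
    (hS : ∀ κ, |a κ| * exp (-(sineFreq κ * s)) ≤ S) {t : ℝ} (ht : s < t) (x : Fin n → ℝ) :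
    |heatSeries a t x| ≤ S * (1 + 1 / (t - s)) ^ n := by
  have hS0 : 0 ≤ S := le_trans (by positivity) (hS 0)
  have h := summable_exp_sineFreq n (sub_pos.2 ht)
  have h1 := tsum_of_norm_bounded (h.1.mul_left S).hasSum (norm_heatSeries_term_le hS t x)
  rw [tsum_mul_left] at h1
  exact h1.trans (by gcongr; exact h.2)

theorem sq_le_sineFreq {n : ℕ} {N : ℕ} {κ : Fin n → ℕ} (h : ∃ i, N < κ i) :
    (N:ℝ) ^ 2 ≤ sineFreq κ := by
  obtain ⟨i, hi⟩ := h
  have h1 : (N:ℝ) ^ 2 ≤ (κ i : ℝ) ^ 2 := by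
    have : (N:ℝ) ≤ κ i := by exact_mod_cast hi.le
    gcongr
  have h2 : (κ i : ℝ) ^ 2 ≤ ∑ j, (κ j : ℝ) ^ 2 :=
    Finset.single_le_sum (f := fun j => (κ j : ℝ) ^ 2) (fun _ _ => sq_nonneg _) (Finset.mem_univ i)
  have h3 : (1:ℝ) ≤ Real.pi ^ 2 := by nlinarith [Real.pi_gt_three]
  unfold sineFreq
  nlinarith [sq_nonneg (κ i : ℝ)]

open Real in
/-- The high frequencies are strongly damped. -/
theorem abs_heatSeries_sub_low_le {n : ℕ} {a : (Fin n → ℕ) → ℝ} {s S : ℝ}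
    (hS : ∀ κ, |a κ| * exp (-(sineFreq κ * s)) ≤ S) {σ : ℝ} (hσ : 0 < σ) {t : ℝ}
    (ht : s + 2 * σ ≤ t) (x : Fin n → ℝ) (N : ℕ) :
    |heatSeries a t x - ∑ κ ∈ Fintype.piFinset fun _ : Fin n => Finset.range (N + 1),
        a κ * (exp (-(sineFreq κ * t)) * sineMode κ x)| ≤
      S * (exp (-(N ^ 2 * σ)) * (1 + 1 / σ) ^ n) := by
  have hS0 : 0 ≤ S := le_trans (by positivity) (hS 0)
  set box := Fintype.piFinset fun _ : Fin n => Finset.range (N + 1) with hbox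
  have hsum := summable_heatSeries hS (t := t) (by linarith) x
  have h := summable_exp_sineFreq n hσ
  -- Of the elapsed time, at least 2σ, one σ yields the gain exp(-N²σ) outside the box and the other
  -- keeps the sum convergent.
  rw [heatSeries, ← hsum.sum_add_tsum_compl (s := box), add_sub_cancel_left]
  have hg : Summable fun κ : ((box : Set (Fin n → ℕ))ᶜ : Set _) =>
      S * exp (-(N ^ 2 * σ)) * exp (-(sineFreq (κ : Fin n → ℕ) * σ)) :=
    (h.1.mul_left (S * exp (-(N ^ 2 * σ)))).subtype _
  rw [← Real.norm_eq_abs]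
  refine (tsum_of_norm_bounded (E := ℝ) hg.hasSum fun κ => ?_).trans ?_
  · refine (norm_heatSeries_term_le hS t x κ).trans ?_
    rw [mul_assoc, ← exp_add]
    have hκ : ∃ i, N < (κ : Fin n → ℕ) i := by
      obtain ⟨κ, hκ⟩ := κ
      have h2 : ¬ ∀ i, κ i ∈ Finset.range (N + 1) := fun h =>
        hκ (Finset.mem_coe.2 (Fintype.mem_piFinset.2 h))
      push Not at h2
      obtain ⟨i, hi⟩ := h2
      exact ⟨i, by rw [Finset.mem_range] at hi; change N < κ i; omega⟩
    have h1 := sq_le_sineFreq hκ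
    gcongr
    nlinarith [sineFreq_nonneg (κ : Fin n → ℕ)]
  · rw [tsum_mul_left, mul_assoc]
    gcongr
    exact (Summable.tsum_subtype_le _ _ (fun _ => (exp_pos _).le) h.1).trans h.2

/-! ### Observability of the sine series by dyadic time windows -/

open Real in
/-- Low modes at the end of a time window are controlled by the observation in the window. -/
theorem low_mode_le {n : ℕ} (i₀ : Fin n) (x₀ α : ℝ) (N : ℕ)
    (δ : ℝ) (hδ : 0 < δ) (hδ1 : δ ≤ 1)
    (hsep : ∀ i j : Fin N, i ≠ j → δ ≤
        |cos (π * ((i + 2 : ℕ) : ℝ) ^ (-α)) - cos (π * ((j + 2 : ℕ) : ℝ) ^ (-α))|)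
    (hsin : ∀ i : Fin N, δ ≤ sin (π * ((i + 2 : ℕ) : ℝ) ^ (-α)))
    {a : (Fin n → ℕ) → ℝ} {s S τ I : ℝ} (hτ : 0 < τ)
    (hS : ∀ κ, |a κ| * exp (-(sineFreq κ * s)) ≤ S)
    (hint : ∀ p : Fin n → Fin N, IntervalIntegrable
      (fun t => heatSeries a t (obsNode i₀ x₀ α p)) MeasureTheory.volume s (s + τ))
    (hI : ∀ p : Fin n → Fin N, ∫ t in s..(s + τ), |heatSeries a t (obsNode i₀ x₀ α p)| ≤ I)
    (κ : Fin n → ℕ) (hκ : ∀ i, 1 ≤ κ i) (hκN : ∀ i, κ i ≤ N) :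
    |a κ| * exp (-(sineFreq κ * (s + τ))) * |sin (π * κ i₀ * x₀)| ≤
      (2 * (1 + 2 * (N + 1) / τ)) ^ N * (N * (2 * (2 / δ) ^ N)) ^ n *
        (I * (2 * (N + 1) / τ) + S * (exp (-(N ^ 2 * (τ / 4))) * (1 + 4 / τ) ^ n)) := by
  -- With this step, all sampling times s + τ/2 + θ + mh, 0 ≤ θ ≤ h, m < N, and the output time (m =
  -- N) lie in the second half of the window. The first half, τ/2 = 2σ with σ = τ/4, damps the high
  -- modes.
  set h := τ / (2 * (N + 1)) with hh
  have hN0 : (0:ℝ) ≤ N := N.cast_nonneg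
  have hh0 : 0 < h := by positivity
  have hinv : 2 * ((N:ℝ) + 1) / τ = 1 / h := by rw [hh]; field_simp
  have hNh : ((N:ℝ) + 1) * h = τ / 2 := by rw [hh]; field_simp
  rw [hinv]
  obtain ⟨C, hC1, hC2⟩ := exists_mode_dual i₀ x₀ α N δ hδ hδ1 hsep hsin κ hκ hκN h hh0
  set W := (2 * (1 + 1 / h)) ^ N * (N * (2 * (2 / δ) ^ N)) ^ n with hW
  set η := S * (exp (-(N ^ 2 * (τ / 4))) * (1 + 4 / τ) ^ n) with hη
  have hS0 : 0 ≤ S := le_trans (by positivity) (hS 0)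
  have hη0 : 0 ≤ η := by positivity
  set F : (Fin n → Fin N) → ℝ → ℝ := fun p t => heatSeries a t (obsNode i₀ x₀ α p) with hF
  set A := |a κ| * exp (-(sineFreq κ * (s + τ))) * |sin (π * κ i₀ * x₀)| with hA
  have hI0 : 0 ≤ I := by
    have hN : 0 < N := (hκ i₀).trans (hκN i₀)
    refine le_trans ?_ (hI fun _ => ⟨0, hN⟩)
    exact intervalIntegral.integral_nonneg (by linarith) fun _ _ => abs_nonneg _
  -- The weights are applied to the true solution instead of its low part, at the price of the tail
  -- `η` at each sample.
  have hpt : ∀ θ ∈ Set.Icc 0 h, A ≤ ∑ m ∈ Finset.range N, ∑ p : Fin n → Fin N,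
      |C m p| * (|F p (θ + (s + τ / 2 + m * h))| + η) := by
    rintro θ ⟨hθ0, hθh⟩
    set t := θ + (s + τ / 2) with ht
    set box := Fintype.piFinset fun _ : Fin n => Finset.range (N + 1) with hbox
    have hκbox : κ ∈ box := by
      rw [hbox, Fintype.mem_piFinset]; intro i; have := hκN i; simp; omega
    have hlow : ∑ m ∈ Finset.range N, ∑ p : Fin n → Fin N, C m p *
          (∑ l ∈ box, a l * (exp (-(sineFreq l * (t + m * h))) * sineMode l (obsNode i₀ x₀ α p))) =
        a κ * (exp (-(sineFreq κ * (t + N * h))) * sin (π * κ i₀ * x₀)) := by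
      have : ∀ l ∈ box, a l * (∑ m ∈ Finset.range N, ∑ p : Fin n → Fin N,
          C m p * (exp (-(sineFreq l * (t + m * h))) * sineMode l (obsNode i₀ x₀ α p))) =
          if l = κ then
            a κ * (exp (-(sineFreq κ * (t + N * h))) * sin (π * κ i₀ * x₀)) else 0 := by
        intro l hl
        rw [hC1 l (fun i => by
          have := Fintype.mem_piFinset.1 hl i
          simpa [Nat.lt_succ_iff] using this) t]
        split_ifs with hlk
        · rw [hlk]
        · rw [mul_zero]
      have h2 := Finset.sum_congr rfl this
      rw [Finset.sum_ite_eq' box κ, if_pos hκbox] at h2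
      rw [← h2]
      simp_rw [Finset.mul_sum]
      rw [Finset.sum_comm (s := box)]
      refine Finset.sum_congr rfl fun m _ => ?_
      rw [Finset.sum_comm]
      exact Finset.sum_congr rfl fun _ _ => Finset.sum_congr rfl fun _ _ => by ring
    have hA1 : A ≤ |a κ * (exp (-(sineFreq κ * (t + N * h))) * sin (π * κ i₀ * x₀))| := by
      rw [abs_mul, abs_mul, abs_exp, hA, mul_assoc]
      have htN : t + N * h ≤ s + τ := by rw [ht]; linarith
      have := exp_le_exp.2 (neg_le_neg (mul_le_mul_of_nonneg_left htN (sineFreq_nonneg κ)))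
      gcongr
    rw [← hlow] at hA1
    refine hA1.trans ((Finset.abs_sum_le_sum_abs _ _).trans (Finset.sum_le_sum fun m _ => ?_))
    refine (Finset.abs_sum_le_sum_abs _ _).trans (Finset.sum_le_sum fun p _ => ?_)
    rw [abs_mul]
    refine mul_le_mul_of_nonneg_left ?_ (abs_nonneg _)
    have htm : θ + (s + τ / 2 + m * h) = t + m * h := by rw [ht]; ring
    rw [htm]
    have hm0 : 0 ≤ (m:ℝ) * h := by positivity
    have := abs_heatSeries_sub_low_le hS (σ := τ / 4) (by positivity) (t := t + m * h)
      (by rw [ht]; linarith) (obsNode i₀ x₀ α p) N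
    rw [one_div_div] at this
    rw [abs_sub_comm] at this
    have h3 := abs_sub_abs_le_abs_sub (∑ l ∈ box, a l * (exp (-(sineFreq l * (t + m * h))) *
      sineMode l (obsNode i₀ x₀ α p))) (heatSeries a (t + m * h) (obsNode i₀ x₀ α p))
    simp only [hF]
    linarith
  have hshift : ∀ m ∈ Finset.range N, ∀ p : Fin n → Fin N,
      IntervalIntegrable (fun θ => |F p (θ + (s + τ / 2 + m * h))|) MeasureTheory.volume 0 h ∧
      ∫ θ in (0:ℝ)..h, |F p (θ + (s + τ / 2 + m * h))| ≤ I := by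
    intro m hm p
    have hmN : (m:ℝ) + 1 ≤ N := by exact_mod_cast Finset.mem_range.1 hm
    have hm0 : 0 ≤ (m:ℝ) * h := by positivity
    have h1 : 0 + (s + τ / 2 + m * h) ∈ Set.Icc s (s + τ) := ⟨by linarith, by nlinarith⟩
    have h2 : h + (s + τ / 2 + m * h) ∈ Set.Icc s (s + τ) := ⟨by linarith, by nlinarith⟩
    have hii : IntervalIntegrable (fun t => |F p t|) MeasureTheory.volume
        (0 + (s + τ / 2 + m * h)) (h + (s + τ / 2 + m * h)) := by
      refine (hint p).abs.mono_set ?_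
      rw [Set.uIcc_of_le (by linarith : s ≤ s + τ)]
      exact Set.uIcc_subset_Icc h1 h2
    constructor
    · have := hii.comp_add_right (s + τ / 2 + m * h)
      simpa using this
    · rw [intervalIntegral.integral_comp_add_right (fun t => |F p t|)]
      refine le_trans ?_ (hI p)
      exact intervalIntegral.integral_mono_interval h1.1 (by linarith) h2.2
        (Filter.Eventually.of_forall fun _ => abs_nonneg _) (hint p).abs
  have hterm : ∀ m ∈ Finset.range N, ∀ p : Fin n → Fin N, IntervalIntegrable
      (fun θ => |C m p| * (|F p (θ + (s + τ / 2 + m * h))| + η)) MeasureTheory.volume 0 h :=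
    fun m hm p => ((hshift m hm p).1.add intervalIntegrable_const).const_mul _
  have hterm' : ∀ m ∈ Finset.range N, IntervalIntegrable (fun θ => ∑ p : Fin n → Fin N,
      |C m p| * (|F p (θ + (s + τ / 2 + m * h))| + η)) MeasureTheory.volume 0 h := by
    intro m hm
    simpa only [Finset.sum_fn] using IntervalIntegrable.sum Finset.univ fun p _ => hterm m hm p
  -- Integrating over the offset θ turns point values in time into integrals over subintervals of
  -- the window, each at most `I`.
  have hmain : h * A ≤ W * (I + h * η) := by
    have hle := intervalIntegral.integral_mono_on (a := 0) (b := h) hh0.le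
      (f := fun _ => A) (g := fun θ => ∑ m ∈ Finset.range N, ∑ p : Fin n → Fin N,
        |C m p| * (|F p (θ + (s + τ / 2 + m * h))| + η)) intervalIntegrable_const
      (by simpa only [Finset.sum_fn] using IntervalIntegrable.sum (Finset.range N) hterm') hpt
    rw [intervalIntegral.integral_const, sub_zero, smul_eq_mul] at hle
    refine hle.trans ?_
    rw [intervalIntegral.integral_finsetSum hterm']
    calc _ ≤ ∑ m ∈ Finset.range N, ∑ p : Fin n → Fin N, |C m p| * (I + h * η) := by
          refine Finset.sum_le_sum fun m hm => ?_
          rw [intervalIntegral.integral_finsetSum fun p _ => hterm m hm p]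
          refine Finset.sum_le_sum fun p _ => ?_
          rw [intervalIntegral.integral_const_mul, intervalIntegral.integral_add
            (hshift m hm p).1 intervalIntegrable_const, intervalIntegral.integral_const, sub_zero,
            smul_eq_mul]
          gcongr
          exact (hshift m hm p).2
      _ = (∑ m ∈ Finset.range N, ∑ p : Fin n → Fin N, |C m p|) * (I + h * η) := by
          simp_rw [Finset.sum_mul]
      _ ≤ _ := by gcongr
  have : A = h * A * (1 / h) := by field_simp
  rw [this]
  calc h * A * (1 / h) ≤ W * (I + h * η) * (1 / h) := by gcongr
    _ = _ := by field_simp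

open Real in
theorem two_pow_le_exp (r : ℕ) : (2:ℝ) ^ r ≤ exp r := by
  have h : (2:ℝ) ≤ exp 1 := by linarith [add_one_le_exp (1:ℝ)]
  calc (2:ℝ) ^ r ≤ exp 1 ^ r := by gcongr
    _ = exp r := by rw [← exp_nat_mul, mul_one]

open Real in
/-- The observability cost of the modes up to `4 ^ r` in a time window of length `2 ^ (-r)`. -/
theorem exists_cost_bound (n B d : ℕ) {c c' : ℝ} (hc : 0 < c) (hc' : 0 < c') :
    ∃ β : ℝ, 0 ≤ β ∧ ∀ r : ℕ,
      ((4:ℝ) ^ r) ^ d / c' * ((2 * (1 + 2 * ((4:ℝ) ^ r + 1) / (1 / 2) ^ r)) ^ (4 ^ r) *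
        ((4:ℝ) ^ r * (2 * (2 / (c / ((4:ℝ) ^ r + 1) ^ B)) ^ (4 ^ r))) ^ n) *
        (2 * ((4:ℝ) ^ r + 1) / (1 / 2) ^ r) ≤ exp (β * (4 ^ r * (r + 1))) := by
  obtain ⟨b₀, hb₀, hcb⟩ : ∃ b : ℝ, 0 ≤ b ∧ 2 / c ≤ exp b :=
    ⟨2 / c, by positivity, by linarith [add_one_le_exp (2 / c)]⟩
  obtain ⟨b₁, hb₁, hcb'⟩ : ∃ b : ℝ, 0 ≤ b ∧ 1 / c' ≤ exp b :=
    ⟨1 / c', by positivity, by linarith [add_one_le_exp (1 / c')]⟩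
  -- The summands account in turn for the Liouville factor, the time weights, the space weights, and
  -- the inverse sampling step. Each factor is at most exp(const · 4^r (r+1)).
  refine ⟨(2 * d + b₁) + (5 + (3 + b₀ + 2 * B) * n) + 3, by positivity, fun r => ?_⟩
  set y : ℝ := (r:ℝ) + 1 with hy
  have hr0 : (0:ℝ) ≤ r := r.cast_nonneg
  have hy1 : 1 ≤ y := by rw [hy]; linarith
  have hy0 : 0 ≤ y := by linarith
  set E : ℝ := (4:ℝ) ^ r with hE
  have hEN : ((4 ^ r : ℕ) : ℝ) = E := by rw [hE]; push_cast; rfl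
  have hE1 : 1 ≤ E := one_le_pow₀ (by norm_num)
  have hyE : y ≤ y * E := le_mul_of_one_le_right hy0 hE1
  have h2 := two_pow_le_exp r
  have hexp1 : (2:ℝ) ≤ exp 1 := by linarith [add_one_le_exp (1:ℝ)]
  have hEe : E ≤ exp (2 * r) := by
    have : E = (2:ℝ) ^ r * (2:ℝ) ^ r := by rw [hE, ← mul_pow]; norm_num
    rw [this, two_mul, exp_add]
    gcongr
  have hEe' : E ≤ exp (2 * y) := hEe.trans (exp_le_exp.2 (by rw [hy]; linarith))
  have hE1e : E + 1 ≤ exp (2 * y) := by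
    calc E + 1 ≤ 2 * E := by linarith
      _ ≤ exp 1 * exp (2 * r) := by gcongr
      _ = exp (1 + 2 * r) := by rw [exp_add]
      _ ≤ _ := exp_le_exp.2 (by rw [hy]; linarith)
  have hinv : 2 * (E + 1) / (1 / 2) ^ r ≤ exp (3 * y) := by
    have : 2 * (E + 1) / (1 / 2) ^ r = 2 * (E + 1) * 2 ^ r := by
      rw [one_div, inv_pow, div_inv_eq_mul]
    rw [this]
    calc 2 * (E + 1) * 2 ^ r ≤ exp 1 * exp (2 * y) * exp r := by gcongr
      _ = exp (1 + 2 * y + r) := by rw [exp_add, exp_add]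
      _ = exp (3 * y) := by congr 1; rw [hy]; ring
  have hexp2 : (4:ℝ) ≤ exp 2 := by
    have : exp (2:ℝ) = exp 1 * exp 1 := by rw [← exp_add]; norm_num
    rw [this]; nlinarith
  have hA : (2 * (1 + 2 * (E + 1) / (1 / 2) ^ r)) ^ (4 ^ r) ≤ exp (5 * (y * E)) := by
    have h1 : 2 * (1 + 2 * (E + 1) / (1 / 2) ^ r) ≤ exp (5 * y) := by
      have h3 : 1 ≤ exp (3 * y) := one_le_exp (by positivity)
      calc _ ≤ 4 * exp (3 * y) := by linarith
        _ ≤ exp 2 * exp (3 * y) := by gcongr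
        _ = exp (2 + 3 * y) := by rw [exp_add]
        _ ≤ _ := exp_le_exp.2 (by linarith)
    calc _ ≤ exp (5 * y) ^ (4 ^ r) := by gcongr
      _ = _ := by rw [← exp_nat_mul, hEN]; congr 1; ring
  have hD : 2 / (c / (E + 1) ^ B) ≤ exp ((b₀ + 2 * B) * y) := by
    have : 2 / (c / (E + 1) ^ B) = 2 / c * (E + 1) ^ B := by field_simp
    rw [this]
    calc 2 / c * (E + 1) ^ B ≤ exp b₀ * exp (2 * y) ^ B := by gcongr
      _ = exp (b₀ + B * (2 * y)) := by rw [← exp_nat_mul, exp_add]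
      _ ≤ _ := exp_le_exp.2 (by nlinarith)
  have hG : (E * (2 * (2 / (c / (E + 1) ^ B)) ^ (4 ^ r))) ^ n ≤
      exp ((3 + b₀ + 2 * B) * n * (y * E)) := by
    have h1 : E * (2 * (2 / (c / (E + 1) ^ B)) ^ (4 ^ r)) ≤ exp ((3 + b₀ + 2 * B) * (y * E)) := by
      calc _ ≤ exp (2 * y) * (exp 1 * exp ((b₀ + 2 * B) * y) ^ (4 ^ r)) := by gcongr
        _ = exp (2 * y + (1 + E * ((b₀ + 2 * B) * y))) := by
            rw [← exp_nat_mul, hEN, exp_add, exp_add]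
        _ ≤ _ := exp_le_exp.2 (by nlinarith)
    calc _ ≤ exp ((3 + b₀ + 2 * B) * (y * E)) ^ n := by gcongr
      _ = _ := by rw [← exp_nat_mul]; congr 1; ring
  have hL : E ^ d / c' ≤ exp ((2 * d + b₁) * (y * E)) := by
    rw [div_eq_mul_one_div]
    calc E ^ d * (1 / c') ≤ exp (2 * y) ^ d * exp b₁ := by gcongr
      _ = exp (d * (2 * y) + b₁) := by rw [← exp_nat_mul, exp_add]
      _ ≤ _ := by
        apply exp_le_exp.2
        have hd0 : (0:ℝ) ≤ d := d.cast_nonneg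
        have : b₁ ≤ b₁ * (y * E) := le_mul_of_one_le_right hb₁ (hy1.trans hyE)
        have := mul_le_mul_of_nonneg_left hyE hd0
        linarith
  have hI : 2 * (E + 1) / (1 / 2) ^ r ≤ exp (3 * (y * E)) :=
    hinv.trans (exp_le_exp.2 (by linarith))
  calc _ ≤ exp ((2 * d + b₁) * (y * E)) * (exp (5 * (y * E)) *
        exp ((3 + b₀ + 2 * B) * n * (y * E))) * exp (3 * (y * E)) := by gcongr
    _ = _ := by rw [← exp_add, ← exp_add, ← exp_add]; congr 1; ring

-- The damping exponent is 16^r · 2^(-r) / 4 = 4^r · 2^r / 4, and 2^r outgrows the factor of order r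
-- in the cost exponent. The cost is taken at scale r + 1, where the incoming estimate is made.
open Real in
theorem exists_cost_mul_damping_le (n : ℕ) {β : ℝ} (hβ : 0 ≤ β) :
    ∃ r₀ : ℕ, ∀ r ≥ r₀, exp (β * (4 ^ (r + 1) * ((r + 1 : ℕ) + 1))) *
      (exp (-(((4:ℝ) ^ r) ^ 2 * ((1 / 2) ^ r / 4))) * (1 + 4 / (1 / 2) ^ r) ^ n) ≤ 1 / 2 := by
  set C : ℝ := 2 * n + 4 * β + 1 with hC
  have hC0 : 0 < C := by positivity
  have ht := tendsto_pow_const_div_const_pow_of_one_lt 1 (r := (2:ℝ)) (by norm_num)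
  have he := (ht.eventually (gt_mem_nhds (show (0:ℝ) < 1 / (12 * C) by positivity))).and
    (Filter.eventually_ge_atTop 1)
  obtain ⟨r₀, hr₀⟩ := Filter.eventually_atTop.1 he
  refine ⟨r₀, fun r hr => ?_⟩
  obtain ⟨h1, h2⟩ := hr₀ r hr
  have hr1 : (1:ℝ) ≤ r := by exact_mod_cast h2
  rw [pow_one, div_lt_div_iff₀ (by positivity) (by positivity), one_mul] at h1
  have h3 : C * (r + 2) ≤ 2 ^ r / 4 := by nlinarith
  set E : ℝ := (4:ℝ) ^ r with hE
  have hE1 : 1 ≤ E := one_le_pow₀ (by norm_num)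
  have h8 : E ^ 2 * ((1 / 2) ^ r / 4) = E * (2 ^ r / 4) := by
    have : E * (1 / 2) ^ r = 2 ^ r := by rw [hE, ← mul_pow]; norm_num
    rw [← this]; ring
  have h5 : (1 + 4 / (1 / 2 : ℝ) ^ r) ^ n ≤ exp (2 * n * (r + 1)) := by
    have hr := two_pow_le_exp r
    have hexp1 : (2:ℝ) ≤ exp 1 := by linarith [add_one_le_exp (1:ℝ)]
    have e5 : (5:ℝ) ≤ exp 2 := by
      have : exp (2:ℝ) = exp 1 * exp 1 := by rw [← exp_add]; norm_num
      rw [this]; nlinarith [exp_one_gt_d9]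
    have : 1 + 4 / (1 / 2 : ℝ) ^ r ≤ exp (2 * (r + 1)) := by
      rw [one_div, inv_pow, div_inv_eq_mul]
      have h1 : (1:ℝ) ≤ 2 ^ r := one_le_pow₀ (by norm_num)
      calc 1 + 4 * (2:ℝ) ^ r ≤ 5 * 2 ^ r := by linarith
        _ ≤ exp 2 * exp r := by gcongr
        _ = exp (2 + r) := by rw [exp_add]
        _ ≤ _ := exp_le_exp.2 (by linarith)
    calc _ ≤ exp (2 * (r + 1)) ^ n := by gcongr
      _ = _ := by rw [← exp_nat_mul]; congr 1; ring
  rw [h8]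
  calc _ ≤ exp (β * (4 ^ (r + 1) * ((r + 1 : ℕ) + 1))) *
        (exp (-(E * (2 ^ r / 4))) * exp (2 * n * (r + 1))) := by gcongr
    _ = exp (β * (4 ^ (r + 1) * ((r + 1 : ℕ) + 1)) + (-(E * (2 ^ r / 4)) + 2 * n * (r + 1))) := by
        rw [← exp_add, ← exp_add]
    _ ≤ exp (-1) := by
        apply exp_le_exp.2
        rw [pow_succ, ← hE]
        push_cast
        have h6 := mul_le_mul_of_nonneg_left h3 (by linarith : 0 ≤ E)
        have h7 : (2 * n + 1) * ((r:ℝ) + 2) ≤ (2 * n + 1) * ((r:ℝ) + 2) * E :=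
          le_mul_of_one_le_right (by positivity) hE1
        have hn0 : (0:ℝ) ≤ n := n.cast_nonneg
        rw [hC] at h6
        nlinarith
    _ ≤ 1 / 2 := by
        rw [exp_neg, ← one_div]
        exact one_div_le_one_div_of_le (by norm_num) (by linarith [add_one_le_exp (1:ℝ)])

open Real in
/-- Observability of the sine series from the nodes. -/
theorem exists_heatSeries_observability {n : ℕ} (i₀ : Fin n) {α x₀ T : ℝ} (hα : 0 < α)
    (hT : 0 < T) (halg : IsAlgebraic ℚ x₀) (hdeg : 1 < (minpoly ℚ x₀).natDegree) :
    ∃ C : ℝ, 0 < C ∧ ∀ (a : (Fin n → ℕ) → ℝ) (M I : ℝ), (∀ κ, |a κ| ≤ M) →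
      (∀ κ, (∃ i, κ i = 0) → a κ = 0) →
      (∀ (N : ℕ) (p : Fin n → Fin N) (s t : ℝ), 0 < s → s ≤ t → t ≤ T →
        IntervalIntegrable (fun t => heatSeries a t (obsNode i₀ x₀ α p)) MeasureTheory.volume s t ∧
        ∫ t in s..t, |heatSeries a t (obsNode i₀ x₀ α p)| ≤ I) →
      0 ≤ I → ∀ x, |heatSeries a T x| ≤ C * I := by
  obtain ⟨c, hc, hc1, B, hsep⟩ := exists_cos_separation hα
  obtain ⟨c', hc', d, hliou⟩ := exists_le_abs_sin_of_isAlgebraic halg hdeg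
  obtain ⟨β, hβ, hcost⟩ := exists_cost_bound n B d hc hc'
  obtain ⟨r₁, hr₁⟩ := exists_cost_mul_damping_le n hβ
  obtain ⟨r₂, hr₂⟩ := exists_pow_lt_of_lt_one (show 0 < T / 4 by positivity)
    (show (1 / 2 : ℝ) < 1 by norm_num)
  set K : ℕ → ℝ := fun r => exp (β * (4 ^ r * (r + 1))) with hK
  have hK1 : ∀ r, 1 ≤ K r := fun r => one_le_exp (by positivity)
  set r₀ := max r₁ r₂ with hr₀
  have hτ2 : ∀ r ≥ r₀, 2 * (1 / 2 : ℝ) ^ r ≤ T / 2 := by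
    intro r hr
    have : (1 / 2 : ℝ) ^ r ≤ (1 / 2) ^ r₂ :=
      pow_le_pow_of_le_one (by norm_num) (by norm_num) ((le_max_right _ _).trans hr)
    linarith
  refine ⟨3 * K r₀ * (1 + 2 / T) ^ n, by positivity, fun a M I ha ha0 hobs hI x => ?_⟩
  have hM0 : 0 ≤ M := (abs_nonneg _).trans (ha 0)
  -- One window [τ, 2τ] with τ = 2^(-r): a bound K(r+1)·Q at its start becomes K(r)·(I + Q/2) at its
  -- end, because cost times damping is at most 1/2.
  have step : ∀ r ≥ r₀, ∀ Q : ℝ, 0 ≤ Q →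
      (∀ κ, |a κ| * exp (-(sineFreq κ * (1 / 2) ^ r)) ≤ K (r + 1) * Q) →
      ∀ κ, |a κ| * exp (-(sineFreq κ * (2 * (1 / 2) ^ r))) ≤ K r * (I + Q / 2) := by
    intro r hr Q hQ hS κ
    set τ : ℝ := (1 / 2) ^ r with hτ
    have hτ0 : 0 < τ := by positivity
    set ζ := exp (-(((4:ℝ) ^ r) ^ 2 * (τ / 4))) * (1 + 4 / τ) ^ n with hζ
    have hζ0 : 0 ≤ ζ := by positivity
    have hdamp : K (r + 1) * ζ ≤ 1 / 2 := by
      have := hr₁ r ((le_max_left _ _).trans hr)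
      simpa [hK, hζ, hτ] using this
    have hKr := hK1 r
    have hgoal : K r * (I + K (r + 1) * Q * ζ) ≤ K r * (I + Q / 2) := by
      gcongr
      nlinarith
    refine le_trans ?_ hgoal
    have hKQ : 0 ≤ K (r + 1) * Q := mul_nonneg (zero_le_one.trans (hK1 _)) hQ
    by_cases hz : ∃ i, κ i = 0
    · rw [ha0 κ hz, abs_zero, zero_mul]; positivity
    push Not at hz
    -- A mode above the cutoff needs no observation: its own decay over the window suffices.
    by_cases hbig : ∃ i, 4 ^ r < κ i
    · have h1 := sq_le_sineFreq hbig
      push_cast at h1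
      have h2 : exp (-(sineFreq κ * (2 * τ))) ≤ exp (-(sineFreq κ * τ)) *
          exp (-(((4:ℝ) ^ r) ^ 2 * (τ / 4))) := by
        rw [← exp_add]
        apply exp_le_exp.2
        nlinarith [sineFreq_nonneg κ]
      have h3 : (1:ℝ) ≤ (1 + 4 / τ) ^ n := one_le_pow₀ (by
        have : 0 < 4 / τ := by positivity
        linarith)
      calc |a κ| * exp (-(sineFreq κ * (2 * τ)))
          ≤ |a κ| * (exp (-(sineFreq κ * τ)) * exp (-(((4:ℝ) ^ r) ^ 2 * (τ / 4)))) := by gcongr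
        _ = (|a κ| * exp (-(sineFreq κ * τ))) * exp (-(((4:ℝ) ^ r) ^ 2 * (τ / 4))) := by ring
        _ ≤ K (r + 1) * Q * exp (-(((4:ℝ) ^ r) ^ 2 * (τ / 4))) :=
            mul_le_mul_of_nonneg_right (hS κ) (exp_pos _).le
        _ ≤ K (r + 1) * Q * ζ := by
            gcongr
            exact le_mul_of_one_le_right (exp_pos _).le h3
        _ ≤ 1 * (I + K (r + 1) * Q * ζ) := by linarith
        _ ≤ _ := by gcongr
    push Not at hbig
    have hr4 := hτ2 r hr
    have hδ0 : 0 < c / (((4 ^ r : ℕ) : ℝ) + 1) ^ B := by positivity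
    have hδ1 : c / (((4 ^ r : ℕ) : ℝ) + 1) ^ B ≤ 1 := by
      refine div_le_one_of_le₀ (hc1.trans (one_le_pow₀ ?_)) (by positivity)
      linarith [(4 ^ r : ℕ).cast_nonneg (α := ℝ)]
    have hobs' := fun p : Fin n → Fin (4 ^ r) =>
      hobs (4 ^ r) p τ (τ + τ) hτ0 (by linarith) (by linarith)
    have hlow := low_mode_le i₀ x₀ α (4 ^ r) _ hδ0 hδ1 (hsep _).1 (hsep _).2 hτ0 hS
      (fun p => (hobs' p).1) (fun p => (hobs' p).2) κ
      (fun i => Nat.one_le_iff_ne_zero.2 (hz i)) hbig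
    push_cast at hlow
    rw [← two_mul] at hlow
    have hsin : c' / ((4:ℝ) ^ r) ^ d ≤ |sin (π * κ i₀ * x₀)| := by
      refine le_trans ?_ (hliou (κ i₀) (Nat.one_le_iff_ne_zero.2 (hz i₀)))
      have h1 : (κ i₀ : ℝ) ≤ (4:ℝ) ^ r := by exact_mod_cast hbig i₀
      have h2 : (0:ℝ) < κ i₀ := by exact_mod_cast Nat.pos_of_ne_zero (hz i₀)
      gcongr
    set W := (2 * (1 + 2 * ((4:ℝ) ^ r + 1) / τ)) ^ (4 ^ r) *
        ((4:ℝ) ^ r * (2 * (2 / (c / ((4:ℝ) ^ r + 1) ^ B)) ^ (4 ^ r))) ^ n with hW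
    have hW0 : 0 ≤ W := by positivity
    set D := 2 * ((4:ℝ) ^ r + 1) / τ with hD
    have hτ1 : τ ≤ 1 := pow_le_one₀ (by norm_num) (by norm_num)
    have hD1 : 1 ≤ D := by
      rw [hD, le_div_iff₀ hτ0]
      have : (0:ℝ) < 4 ^ r := by positivity
      linarith
    have hcr : ((4:ℝ) ^ r) ^ d / c' * W * D ≤ K r := hcost r
    set A := |a κ| * exp (-(sineFreq κ * (2 * τ))) with hA
    have hA0 : 0 ≤ A := by positivity
    have h1 : A * (c' / ((4:ℝ) ^ r) ^ d) ≤ W * (I * D + K (r + 1) * Q * ζ) :=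
      (mul_le_mul_of_nonneg_left hsin hA0).trans hlow
    have h2 : A = A * (c' / ((4:ℝ) ^ r) ^ d) * (((4:ℝ) ^ r) ^ d / c') := by field_simp
    rw [h2]
    calc _ ≤ W * (I * D + K (r + 1) * Q * ζ) * (((4:ℝ) ^ r) ^ d / c') := by gcongr
      _ ≤ W * (I * D + K (r + 1) * Q * ζ * D) * (((4:ℝ) ^ r) ^ d / c') := by
          have : K (r + 1) * Q * ζ ≤ K (r + 1) * Q * ζ * D :=
            le_mul_of_one_le_right (by positivity) hD1
          gcongr
      _ = ((4:ℝ) ^ r) ^ d / c' * W * D * (I + K (r + 1) * Q * ζ) := by ring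
      _ ≤ _ := by gcongr
  -- The end of window r + 1 is the start of window r. The map Q ↦ I + Q/2 fixes 2I and halves the
  -- excess, so J steps, begun J scales lower with the trivial bound M, leave M/2^J.
  have claim : ∀ J : ℕ, ∀ r ≥ r₀, ∀ κ, |a κ| * exp (-(sineFreq κ * (2 * (1 / 2) ^ r))) ≤
      K r * (2 * I + M / 2 ^ J) := by
    intro J
    induction J with
    | zero =>
      intro r _ κ
      have h1 : exp (-(sineFreq κ * (2 * (1 / 2) ^ r))) ≤ 1 := by
        rw [exp_le_one_iff, Left.neg_nonpos_iff]
        exact mul_nonneg (sineFreq_nonneg κ) (by positivity)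
      calc _ ≤ M * 1 := by gcongr; exact ha κ
        _ ≤ 1 * (2 * I + M / 2 ^ 0) := by rw [pow_zero, div_one]; linarith
        _ ≤ _ := by gcongr; exact hK1 r
    | succ J ih =>
      intro r hr κ
      have e : ∀ r : ℕ, 2 * (1 / 2 : ℝ) ^ (r + 1) = (1 / 2) ^ r := fun r => by
        rw [pow_succ]; ring
      have := step r hr (2 * I + M / 2 ^ J) (by positivity) (fun κ => by
        have := ih (r + 1) (by omega) κ
        rwa [e] at this) κ
      refine this.trans (le_of_eq ?_)
      congr 1
      rw [pow_succ]
      field_simp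
      ring
  -- Letting J tend to infinity removes the a priori bound on the initial coefficients.
  have hfin : ∀ κ, |a κ| * exp (-(sineFreq κ * (2 * (1 / 2) ^ r₀))) ≤ K r₀ * (2 * I) := by
    intro κ
    have hlim : Filter.Tendsto (fun J : ℕ => K r₀ * (2 * I + M / 2 ^ J)) Filter.atTop
        (nhds (K r₀ * (2 * I + 0))) := by
      refine Filter.Tendsto.const_mul _ (Filter.Tendsto.const_add _ ?_)
      have := (tendsto_pow_atTop_nhds_zero_of_lt_one (r := (1 / 2 : ℝ)) (by norm_num)
        (by norm_num)).const_mul M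
      simpa [div_eq_mul_inv] using this
    rw [add_zero] at hlim
    exact ge_of_tendsto' hlim fun J => claim J r₀ le_rfl κ
  have h0 := hτ2 r₀ le_rfl
  have hb := abs_heatSeries_le hfin (t := T) (by linarith) x
  refine hb.trans ?_
  have h1 : 1 / (T - 2 * (1 / 2) ^ r₀) ≤ 2 / T := by
    rw [div_le_div_iff₀ (by linarith) hT]; linarith
  have h2 : 0 < 1 / (T - 2 * (1 / 2) ^ r₀) := by
    apply one_div_pos.2; linarith
  calc _ ≤ K r₀ * (2 * I) * (1 + 2 / T) ^ n := by gcongr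
    _ ≤ K r₀ * (3 * I) * (1 + 2 / T) ^ n := by gcongr; norm_num
    _ = _ := by ring

/-! ### Product functions on the cube and integration by parts -/

theorem isOpen_openUnitCube (n : ℕ) : IsOpen (openUnitCube n) := by
  have : openUnitCube n = ⋂ i, (fun x : EuclideanSpace ℝ (Fin n) => x i) ⁻¹' Set.Ioo 0 1 := by
    ext x; simp [openUnitCube]
  rw [this]
  exact isOpen_iInter_of_finite fun i => isOpen_Ioo.preimage (by fun_prop)

theorem openUnitCube_eq_preimage (n : ℕ) : openUnitCube n =
    WithLp.ofLp ⁻¹' (Set.univ.pi fun _ : Fin n => Set.Ioo (0:ℝ) 1) := by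
  ext x; simp [openUnitCube]

theorem volume_openUnitCube (n : ℕ) : MeasureTheory.volume (openUnitCube n) = 1 := by
  rw [openUnitCube_eq_preimage,
    (PiLp.volume_preserving_ofLp (Fin n)).measure_preimage
      (MeasurableSet.univ_pi fun _ => measurableSet_Ioo).nullMeasurableSet,
    Real.volume_pi_Ioo]
  simp

instance isProbabilityMeasure_openUnitCube (n : ℕ) :
    MeasureTheory.IsProbabilityMeasure (MeasureTheory.volume.restrict (openUnitCube n)) :=
  ⟨by rw [MeasureTheory.Measure.restrict_apply_univ, volume_openUnitCube]⟩

/-- The product of functions of the single coordinates. -/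
def prodFun {n : ℕ} (h : Fin n → ℝ → ℝ) (x : EuclideanSpace ℝ (Fin n)) : ℝ :=
  ∏ i, h i (x i)

theorem contDiff_prodFun {n : ℕ} {h : Fin n → ℝ → ℝ} {m : WithTop ℕ∞}
    (hh : ∀ i, ContDiff ℝ m (h i)) : ContDiff ℝ m (prodFun h) := by
  unfold prodFun
  refine contDiff_prod fun i _ => (hh i).comp ?_
  exact (EuclideanSpace.proj (𝕜 := ℝ) i).contDiff

theorem abs_prodFun_le {n : ℕ} {h : Fin n → ℝ → ℝ} {x : EuclideanSpace ℝ (Fin n)} {C : Fin n → ℝ}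
    (hC : ∀ i, |h i (x i)| ≤ C i) : |prodFun h x| ≤ ∏ i, C i := by
  unfold prodFun
  rw [Finset.abs_prod]
  exact Finset.prod_le_prod (fun _ _ => abs_nonneg _) fun i _ => hC i

theorem fderiv_prodFun_single {n : ℕ} {h : Fin n → ℝ → ℝ} (hh : ∀ i, Differentiable ℝ (h i))
    (x : EuclideanSpace ℝ (Fin n)) (i : Fin n) :
    fderiv ℝ (prodFun h) x (EuclideanSpace.single i 1) =
      prodFun (Function.update h i (deriv (h i))) x := by
  have hd : ∀ j ∈ Finset.univ, HasFDerivAt (fun x : EuclideanSpace ℝ (Fin n) => h j (x j))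
      (deriv (h j) (x j) • (EuclideanSpace.proj j : EuclideanSpace ℝ (Fin n) →L[ℝ] ℝ)) x := by
    intro j _
    have h1 := (hh j (x j)).hasDerivAt
    have h2 := (EuclideanSpace.proj j : EuclideanSpace ℝ (Fin n) →L[ℝ] ℝ).hasFDerivAt (x := x)
    exact HasDerivAt.comp_hasFDerivAt x h1 h2
  have := (HasFDerivAt.finsetProd hd).fderiv
  unfold prodFun
  rw [this, sum_apply, Finset.sum_eq_single i]
  · rw [← Finset.prod_erase_mul _ _ (Finset.mem_univ i)]
    have hp : (EuclideanSpace.proj i : EuclideanSpace ℝ (Fin n) →L[ℝ] ℝ)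
        (EuclideanSpace.single i 1) = 1 := by simp
    simp only [smul_apply, Function.update_self, smul_eq_mul, hp, mul_one]
    congr 1
    refine Finset.prod_congr rfl fun j hj => ?_
    rw [Function.update_of_ne (Finset.ne_of_mem_erase hj)]
  · intro j _ hj
    simp [hj]
  · simp

theorem gradient_apply {n : ℕ} (f : EuclideanSpace ℝ (Fin n) → ℝ) (x : EuclideanSpace ℝ (Fin n))
    (i : Fin n) : gradient f x i = fderiv ℝ f x (EuclideanSpace.single i 1) := by
  have : inner ℝ (gradient f x) (EuclideanSpace.single i (1:ℝ)) =
      fderiv ℝ f x (EuclideanSpace.single i 1) := InnerProductSpace.toDual_symm_apply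
  rw [← this, EuclideanSpace.inner_single_right]
  simp

theorem continuous_gradient {n : ℕ} {f : EuclideanSpace ℝ (Fin n) → ℝ} (hf : ContDiff ℝ 1 f) :
    Continuous (gradient f) :=
  (InnerProductSpace.toDual ℝ (EuclideanSpace ℝ (Fin n))).symm.continuous.comp
    (hf.continuous_fderiv one_ne_zero)

theorem norm_le_of_abs_apply_le {n : ℕ} {v : EuclideanSpace ℝ (Fin n)} {C : ℝ} (hC : 0 ≤ C)
    (h : ∀ i, |v i| ≤ C) : ‖v‖ ≤ n * C := by
  have h1 : ‖v‖ ^ 2 ≤ (n * C) ^ 2 := by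
    rw [EuclideanSpace.real_norm_sq_eq]
    calc ∑ i, v i ^ 2 ≤ ∑ _i : Fin n, C ^ 2 :=
          Finset.sum_le_sum fun i _ => sq_le_sq' (abs_le.1 (h i)).1 (abs_le.1 (h i)).2
      _ = n * C ^ 2 := by simp
      _ ≤ (n * C) ^ 2 := by
          rw [mul_pow]
          gcongr
          exact_mod_cast Nat.le_self_pow two_ne_zero n
  exact le_of_sq_le_sq h1 (by positivity)

open MeasureTheory

/-- Integration by parts against a compactly supported function. -/
theorem integral_mul_fderiv_eq_neg {n : ℕ} {f ψ : EuclideanSpace ℝ (Fin n) → ℝ}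
    (hf : ContDiff ℝ 1 f) (hψ : ContDiff ℝ 1 ψ) (hc : HasCompactSupport ψ)
    (v : EuclideanSpace ℝ (Fin n)) :
    ∫ x, f x * fderiv ℝ ψ x v = - ∫ x, fderiv ℝ f x v * ψ x := by
  have cf := hf.continuous
  have cψ := hψ.continuous
  have cf' : Continuous fun x => fderiv ℝ f x v :=
    (hf.continuous_fderiv one_ne_zero).clm_apply continuous_const
  have cψ' : Continuous fun x => fderiv ℝ ψ x v :=
    (hψ.continuous_fderiv one_ne_zero).clm_apply continuous_const
  have hc' : HasCompactSupport fun x => fderiv ℝ ψ x v := hc.fderiv_apply ℝ v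
  refine integral_mul_fderiv_eq_neg_fderiv_mul_of_integrable ?_ ?_ ?_
    (fun x _ => hf.differentiable one_ne_zero x) (fun x _ => hψ.differentiable one_ne_zero x)
  · exact (cf'.mul cψ).integrable_of_hasCompactSupport hc.mul_left
  · exact (cf.mul cψ').integrable_of_hasCompactSupport hc'.mul_left
  · exact (cf.mul cψ).integrable_of_hasCompactSupport hc.mul_left

/-- Vanishing is asked only where the germ of ψ vanishes, so that integrands containing derivatives
of ψ are covered. -/
theorem setIntegral_eq_of_tsupport_subset {n : ℕ} {V : Type*} [NormedAddCommGroup V]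
    [NormedSpace ℝ V] {Ω : Set (EuclideanSpace ℝ (Fin n))} {ψ : EuclideanSpace ℝ (Fin n) → ℝ}
    (hΩ : tsupport ψ ⊆ Ω) {F : EuclideanSpace ℝ (Fin n) → V}
    (hF : ∀ x, ψ =ᶠ[nhds x] 0 → F x = 0) : ∫ x in Ω, F x = ∫ x, F x := by
  refine setIntegral_eq_integral_of_forall_compl_eq_zero fun x hx => hF x ?_
  exact notMem_tsupport_iff_eventuallyEq.1 fun h => hx (hΩ h)

theorem fderiv_eq_zero_of_eventuallyEq {n : ℕ} {ψ : EuclideanSpace ℝ (Fin n) → ℝ}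
    {x : EuclideanSpace ℝ (Fin n)} (h : ψ =ᶠ[nhds x] 0) : fderiv ℝ ψ x = 0 := by
  rw [h.fderiv_eq]; simp

theorem gradient_eq_zero_of_eventuallyEq {n : ℕ} {ψ : EuclideanSpace ℝ (Fin n) → ℝ}
    {x : EuclideanSpace ℝ (Fin n)} (h : ψ =ᶠ[nhds x] 0) : gradient ψ x = 0 := by
  ext i
  rw [gradient_apply, fderiv_eq_zero_of_eventuallyEq h]; simp

theorem IsTestFunction.contDiff_one {E : Type*} [NormedAddCommGroup E] [NormedSpace ℝ E]
    {Ω : Set E} {φ : E → ℝ} (h : IsTestFunction Ω φ) : ContDiff ℝ 1 φ :=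
  h.1.of_le (by exact_mod_cast le_top)

/-- The classical gradient of a `C¹` function is its weak gradient. -/
theorem hasWeakGradient_of_contDiff {n : ℕ} (Ω : Set (EuclideanSpace ℝ (Fin n)))
    {f : EuclideanSpace ℝ (Fin n) → ℝ} (hf : ContDiff ℝ 1 f) :
    HasWeakGradient Ω f (gradient f) := by
  intro ψ hψ
  have hψ1 := hψ.contDiff_one
  rw [setIntegral_eq_of_tsupport_subset hψ.2.2 (fun x hx => by
      rw [gradient_eq_zero_of_eventuallyEq hx, smul_zero]),
    setIntegral_eq_of_tsupport_subset hψ.2.2 (fun x hx => by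
      rw [hx.self_of_nhds]; simp)]
  have i1 : Integrable fun x => f x • gradient ψ x := by
    refine (hf.continuous.smul (continuous_gradient hψ1)).integrable_of_hasCompactSupport ?_
    refine HasCompactSupport.smul_left ?_
    refine hψ.2.1.mono' ?_
    intro x hx
    by_contra hx'
    exact hx (gradient_eq_zero_of_eventuallyEq (notMem_tsupport_iff_eventuallyEq.1 hx'))
  have i2 : Integrable fun x => ψ x • gradient f x :=
    (hψ1.continuous.smul (continuous_gradient hf)).integrable_of_hasCompactSupport
      hψ.2.1.smul_right
  ext i
  have p : ∀ F : EuclideanSpace ℝ (Fin n) → EuclideanSpace ℝ (Fin n), Integrable F →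
      (∫ x, F x) i = ∫ x, F x i := fun F hF =>
    ((EuclideanSpace.proj i : EuclideanSpace ℝ (Fin n) →L[ℝ] ℝ).integral_comp_comm hF).symm
  rw [PiLp.neg_apply, p _ i1, p _ i2]
  simp only [PiLp.smul_apply, smul_eq_mul, gradient_apply]
  rw [integral_mul_fderiv_eq_neg hf hψ1 hψ.2.1]
  simp_rw [mul_comm]

/-- Transfers the one-dimensional eigenvalue relation for the second derivative to the product. -/
theorem prodFun_congr_const_mul {n : ℕ} {h : Fin n → ℝ → ℝ} {i : Fin n} {g : ℝ → ℝ} {c : ℝ}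
    (hg : ∀ y, g y = c * h i y) (x : EuclideanSpace ℝ (Fin n)) :
    prodFun (Function.update h i g) x = c * prodFun h x := by
  unfold prodFun
  rw [← Finset.mul_prod_erase _ _ (Finset.mem_univ i),
    ← Finset.mul_prod_erase _ (fun j => h j (x j)) (Finset.mem_univ i), Function.update_self, hg,
    mul_assoc]
  congr 2
  exact Finset.prod_congr rfl fun j hj => by
    rw [Function.update_of_ne (Finset.ne_of_mem_erase hj)]

/-- `sineMode κ` as a function on Euclidean space. -/
noncomputable def sineFun {n : ℕ} (κ : Fin n → ℕ) : EuclideanSpace ℝ (Fin n) → ℝ :=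
  prodFun fun i y => Real.sin (Real.pi * κ i * y)

theorem sineFun_apply {n : ℕ} (κ : Fin n → ℕ) (x : EuclideanSpace ℝ (Fin n)) :
    sineFun κ x = sineMode κ x.ofLp := rfl

theorem contDiff_sineFun {n : ℕ} (κ : Fin n → ℕ) {m : WithTop ℕ∞} : ContDiff ℝ m (sineFun κ) :=
  contDiff_prodFun fun i => by fun_prop

theorem deriv_sin_mul (c : ℝ) :
    deriv (fun y => Real.sin (c * y)) = fun y => c * Real.cos (c * y) := by
  ext y
  have := ((hasDerivAt_id y).const_mul c).sin.deriv
  simpa [mul_comm] using this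

theorem deriv_mul_cos (c : ℝ) :
    deriv (fun y => c * Real.cos (c * y)) = fun y => -c ^ 2 * Real.sin (c * y) := by
  ext y
  have := (((hasDerivAt_id y).const_mul c).cos.const_mul c).deriv
  simp only [id, mul_one] at this
  rw [this]; ring

/-- `sineFun κ` is a Dirichlet eigenfunction, tested against test functions. -/
theorem integral_inner_gradient_sineFun {n : ℕ} (Ω : Set (EuclideanSpace ℝ (Fin n)))
    (κ : Fin n → ℕ) {ψ : EuclideanSpace ℝ (Fin n) → ℝ} (hψ : IsTestFunction Ω ψ) :
    ∫ x in Ω, inner ℝ (gradient ψ x) (gradient (sineFun κ) x) =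
      sineFreq κ * ∫ x in Ω, ψ x * sineFun κ x := by
  have hψ1 := hψ.contDiff_one
  rw [setIntegral_eq_of_tsupport_subset hψ.2.2 (fun x hx => by
      rw [gradient_eq_zero_of_eventuallyEq hx, inner_zero_left]),
    setIntegral_eq_of_tsupport_subset hψ.2.2 (fun x hx => by
      rw [hx.self_of_nhds]; simp)]
  set h : Fin n → ℝ → ℝ := fun i y => Real.sin (Real.pi * κ i * y) with hh
  have hdiff : ∀ i, Differentiable ℝ (h i) := fun i => by simp only [hh]; fun_prop
  -- The partial derivatives of the eigenfunction. Integrating by parts in each direction moves the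
  -- derivative from ψ onto them.
  set D : Fin n → EuclideanSpace ℝ (Fin n) → ℝ :=
    fun i => prodFun (Function.update h i (deriv (h i))) with hD
  have hDh : ∀ i, ∀ j, ContDiff ℝ 1 (Function.update h i (deriv (h i)) j) := by
    intro i j
    by_cases hij : j = i
    · subst hij
      rw [Function.update_self, hh]
      simp only [deriv_sin_mul]
      fun_prop
    · rw [Function.update_of_ne hij, hh]; fun_prop
  have hD1 : ∀ i, ContDiff ℝ 1 (D i) := fun i => contDiff_prodFun (hDh i)
  have hDD : ∀ i x, fderiv ℝ (D i) x (EuclideanSpace.single i 1) =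
      -(Real.pi * κ i) ^ 2 * sineFun κ x := by
    intro i x
    rw [hD, fderiv_prodFun_single (fun j => (hDh i j).differentiable one_ne_zero),
      Function.update_self, Function.update_idem]
    refine prodFun_congr_const_mul (fun y => ?_) x
    simp only [hh, deriv_sin_mul, deriv_mul_cos]
  have hinner : ∀ x, inner ℝ (gradient ψ x) (gradient (sineFun κ) x) =
      ∑ i, D i x * fderiv ℝ ψ x (EuclideanSpace.single i 1) := by
    intro x
    rw [PiLp.inner_apply]
    refine Finset.sum_congr rfl fun i _ => ?_
    rw [gradient_apply, gradient_apply, sineFun, fderiv_prodFun_single hdiff]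
    rfl
  simp_rw [hinner]
  rw [integral_finsetSum]
  · have : ∀ i, ∫ x, D i x * fderiv ℝ ψ x (EuclideanSpace.single i 1) =
        (Real.pi * κ i) ^ 2 * ∫ x, ψ x * sineFun κ x := by
      intro i
      rw [integral_mul_fderiv_eq_neg (hD1 i) hψ1 hψ.2.1, ← integral_const_mul, ← integral_neg]
      refine integral_congr_ae (Filter.Eventually.of_forall fun x => ?_)
      simp only [hDD]; ring
    simp_rw [this]
    rw [← Finset.sum_mul, sineFreq, Finset.mul_sum]
    simp_rw [mul_pow]
  · intro i _
    have c' : Continuous fun x => fderiv ℝ ψ x (EuclideanSpace.single i 1) :=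
      (hψ1.continuous_fderiv one_ne_zero).clm_apply continuous_const
    exact ((hD1 i).continuous.mul c').integrable_of_hasCompactSupport
      (HasCompactSupport.mul_left (hψ.2.1.fderiv_apply ℝ _))

/-! ### The sine eigenfunctions in H₀¹ -/

theorem MemLp.integrable_inner_of_bound {X V : Type*} [MeasurableSpace X] {μ : Measure X}
    [IsFiniteMeasure μ] [NormedAddCommGroup V] [InnerProductSpace ℝ V] {f w : X → V} {C : ℝ}
    (hf : MemLp f 2 μ) (hw : AEStronglyMeasurable w μ) (hC : ∀ᵐ x ∂μ, ‖w x‖ ≤ C) :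
    Integrable (fun x => (inner ℝ (f x) (w x) : ℝ)) μ := by
  refine ((hf.integrable one_le_two).norm.const_mul C).mono' (hf.1.inner hw) ?_
  filter_upwards [hC] with x hx
  rw [mul_comm]
  exact (norm_inner_le_norm _ _).trans (by gcongr)

/-- Convergence in `L²` on a probability space passes to integrals against bounded functions. -/
theorem tendsto_integral_inner_of_eLpNorm {X V : Type*} [MeasurableSpace X] {μ : Measure X}
    [IsProbabilityMeasure μ] [NormedAddCommGroup V] [InnerProductSpace ℝ V] {ι : Type*}
    {l : Filter ι} {F : ι → X → V} {f w : X → V} {C : ℝ}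
    (hF : ∀ j, MemLp (F j) 2 μ) (hf : MemLp f 2 μ) (hw : AEStronglyMeasurable w μ)
    (hC : ∀ᵐ x ∂μ, ‖w x‖ ≤ C)
    (hlim : Filter.Tendsto (fun j => eLpNorm (fun x => F j x - f x) 2 μ) l (nhds 0)) :
    Filter.Tendsto (fun j => ∫ x, inner ℝ (F j x) (w x) ∂μ) l
      (nhds (∫ x, inner ℝ (f x) (w x) ∂μ)) := by
  refine tendsto_integral_of_L1' _ (hf.1.inner hw)
    (Filter.Eventually.of_forall fun j => MemLp.integrable_inner_of_bound (hF j) hw hC) ?_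
  have hb : ∀ j, eLpNorm ((fun x => inner ℝ (F j x) (w x)) - fun x => inner ℝ (f x) (w x)) 1 μ ≤
      ENNReal.ofReal C * eLpNorm (fun x => F j x - f x) 2 μ := by
    intro j
    calc _ ≤ ENNReal.ofReal C * eLpNorm (fun x => F j x - f x) 1 μ := by
          refine eLpNorm_le_mul_eLpNorm_of_ae_le_mul ?_ 1
          filter_upwards [hC] with x hx
          simp only [Pi.sub_apply]
          rw [← inner_sub_left, mul_comm]
          exact (norm_inner_le_norm _ _).trans (by gcongr)
      _ ≤ _ := by
          gcongr
          exact eLpNorm_le_eLpNorm_of_exponent_le (by norm_num) ((hF j).1.sub hf.1)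
  refine tendsto_of_tendsto_of_tendsto_of_le_of_le tendsto_const_nhds ?_ (fun _ => zero_le) hb
  have := ENNReal.Tendsto.const_mul hlim (Or.inr (ENNReal.ofReal_ne_top (r := C)))
  rwa [mul_zero] at this

/-- Bounded convergence in `L²` for sequences which are eventually zero at almost every point. -/
theorem tendsto_eLpNorm_two_zero_of_bounded {X V : Type*} [MeasurableSpace X] {μ : Measure X}
    [IsFiniteMeasure μ] [NormedAddCommGroup V] {F : ℕ → X → V} {C : ℝ}
    (hF : ∀ j, AEStronglyMeasurable (F j) μ) (hC : ∀ j, ∀ x, ‖F j x‖ ≤ C)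
    (hlim : ∀ᵐ x ∂μ, ∀ᶠ j in Filter.atTop, F j x = 0) :
    Filter.Tendsto (fun j => eLpNorm (F j) 2 μ) Filter.atTop (nhds 0) := by
  have h1 : Filter.Tendsto (fun j => ∫⁻ x, ‖F j x‖ₑ ^ (2:ℝ) ∂μ) Filter.atTop
      (nhds (∫⁻ _x, 0 ∂μ)) := by
    refine tendsto_lintegral_of_dominated_convergence' (fun _ => ENNReal.ofReal C ^ (2:ℝ))
      (fun j => (hF j).enorm.pow_const _) (fun j => ?_) ?_ ?_
    · refine Filter.Eventually.of_forall fun x => ?_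
      refine ENNReal.rpow_le_rpow ?_ (by norm_num)
      rw [← ofReal_norm]
      exact ENNReal.ofReal_le_ofReal (hC j x)
    · rw [lintegral_const]
      exact ENNReal.mul_ne_top (ENNReal.rpow_ne_top_of_nonneg (by norm_num) ENNReal.ofReal_ne_top)
        (measure_ne_top _ _)
    · filter_upwards [hlim] with x hx
      refine tendsto_const_nhds.congr' ?_
      filter_upwards [hx] with j hj
      simp [hj]
  rw [lintegral_zero] at h1
  have h2 := (ENNReal.continuous_rpow_const (y := 1 / 2)).tendsto 0 |>.comp h1
  rw [ENNReal.zero_rpow_of_pos (by norm_num)] at h2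
  refine h2.congr fun j => ?_
  rw [eLpNorm_eq_lintegral_rpow_enorm_toReal (by norm_num) (by norm_num)]
  simp

/-- The derivative of the smooth step is compactly supported, hence bounded with linear weight. -/
theorem exists_deriv_smoothTransition_bound :
    ∃ M : ℝ, 0 ≤ M ∧ ∀ z, |deriv Real.smoothTransition z| * |z + 1| ≤ M := by
  have hc : Continuous fun z => |deriv Real.smoothTransition z| * |z + 1| := by
    have : Continuous (deriv Real.smoothTransition) :=
      (Real.smoothTransition.contDiff (n := 1)).continuous_deriv le_rfl
    fun_prop
  obtain ⟨M, hM⟩ := (isCompact_Icc (a := (0:ℝ)) (b := 1)).exists_bound_of_continuousOn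
    hc.continuousOn
  refine ⟨M, (norm_nonneg _).trans (hM 0 (by simp)), fun z => ?_⟩
  by_cases hz : z ∈ Set.Icc (0:ℝ) 1
  · exact (le_abs_self _).trans (hM z hz)
  · have h0 : deriv Real.smoothTransition z = 0 := by
      rw [Set.mem_Icc, not_and_or, not_le, not_le] at hz
      rcases hz with hz | hz
      · have : Real.smoothTransition =ᶠ[nhds z] fun _ => 0 := by
          filter_upwards [Iio_mem_nhds hz] with y hy
          exact Real.smoothTransition.zero_of_nonpos hy.le
        rw [this.deriv_eq, deriv_const]
      · have : Real.smoothTransition =ᶠ[nhds z] fun _ => 1 := by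
          filter_upwards [Ioi_mem_nhds hz] with y hy
          exact Real.smoothTransition.one_of_one_le hy.le
        rw [this.deriv_eq, deriv_const]
    rw [h0, abs_zero, zero_mul]
    exact (norm_nonneg _).trans (hM 0 (by simp))

/-- A sine, cut off near the ends of the unit interval at distance `1 / (j + 1)`. -/
noncomputable def cutoffSine (k j : ℕ) (y : ℝ) : ℝ :=
  Real.smoothTransition ((j + 1) * y - 1) * Real.smoothTransition ((j + 1) * (1 - y) - 1) *
    Real.sin (Real.pi * k * y)

theorem contDiff_cutoffSine (k j : ℕ) : ContDiff ℝ ((⊤ : ℕ∞) : WithTop ℕ∞) (cutoffSine k j) := by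
  unfold cutoffSine
  have h1 := (Real.smoothTransition.contDiff (n := ⊤)).comp
    (show ContDiff ℝ ((⊤ : ℕ∞) : WithTop ℕ∞) fun y : ℝ => ((j:ℝ) + 1) * y - 1 by fun_prop)
  have h2 := (Real.smoothTransition.contDiff (n := ⊤)).comp
    (show ContDiff ℝ ((⊤ : ℕ∞) : WithTop ℕ∞) fun y : ℝ => ((j:ℝ) + 1) * (1 - y) - 1 by fun_prop)
  exact (h1.mul h2).mul (by fun_prop)

theorem cutoffSine_eq_zero {k j : ℕ} {y : ℝ}
    (hy : y ∉ Set.Icc (1 / ((j:ℝ) + 1)) (1 - 1 / ((j:ℝ) + 1))) : cutoffSine k j y = 0 := by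
  have hj : (0:ℝ) < (j:ℝ) + 1 := by positivity
  rw [Set.mem_Icc, not_and_or, not_le, not_le] at hy
  unfold cutoffSine
  rcases hy with hy | hy
  · rw [Real.smoothTransition.zero_of_nonpos, zero_mul, zero_mul]
    rw [lt_div_iff₀ hj] at hy
    linarith
  · rw [Real.smoothTransition.zero_of_nonpos (x := ((j:ℝ) + 1) * (1 - y) - 1), mul_zero, zero_mul]
    have : 1 - y < 1 / ((j:ℝ) + 1) := by linarith
    rw [lt_div_iff₀ hj] at this
    linarith

theorem abs_cutoffSine_le (k j : ℕ) (y : ℝ) : |cutoffSine k j y| ≤ 1 := by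
  unfold cutoffSine
  rw [abs_mul, abs_mul, abs_of_nonneg (Real.smoothTransition.nonneg _),
    abs_of_nonneg (Real.smoothTransition.nonneg _)]
  refine mul_le_one₀ (mul_le_one₀ (Real.smoothTransition.le_one _)
    (Real.smoothTransition.nonneg _) (Real.smoothTransition.le_one _)) (abs_nonneg _)
    (Real.abs_sin_le_one _)

theorem abs_sin_le_mul_abs_one_sub (k : ℕ) (y : ℝ) :
    |Real.sin (Real.pi * k * y)| ≤ Real.pi * k * |1 - y| := by
  have h : |Real.sin (Real.pi * k * y)| = |Real.sin (Real.pi * k * (1 - y))| := by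
    have e : Real.pi * k * (1 - y) = -(Real.pi * k * y - (k:ℤ) * Real.pi) := by push_cast; ring
    rw [e, Real.sin_neg, abs_neg, Real.sin_sub_int_mul_pi, abs_mul]
    simp
  rw [h]
  refine Real.abs_sin_le_abs.trans ?_
  rw [abs_mul, abs_of_nonneg (by positivity)]

/-- The cutoff has slope of order j, but only at distance of order 1/j from the ends, where the sine
is O(1/j). Its derivatives are thus bounded uniformly in j, which permits dominated convergence of
the gradients. -/
theorem exists_deriv_cutoffSine_bound (k : ℕ) :
    ∃ C : ℝ, 0 ≤ C ∧ ∀ j y, |deriv (cutoffSine k j) y| ≤ C := by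
  obtain ⟨M, hM, hb⟩ := exists_deriv_smoothTransition_bound
  have hpk : 0 ≤ Real.pi * k := by positivity
  refine ⟨Real.pi * k * M + Real.pi * k * M + Real.pi * k, by positivity, fun j y => ?_⟩
  set J : ℝ := (j:ℝ) + 1 with hJ
  have hJ0 : 0 < J := by positivity
  have hst : ∀ z, HasDerivAt Real.smoothTransition (deriv Real.smoothTransition z) z := fun z =>
    ((Real.smoothTransition.contDiff (n := 1)).differentiable one_ne_zero z).hasDerivAt
  have l1 : HasDerivAt (fun y : ℝ => J * y - 1) J y := by
    simpa using ((hasDerivAt_id y).const_mul J).sub_const 1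
  have l2 : HasDerivAt (fun y : ℝ => J * (1 - y) - 1) (-J) y := by
    simpa using (((hasDerivAt_id y).const_sub 1).const_mul J).sub_const 1
  have l3 : HasDerivAt (fun y : ℝ => Real.sin (Real.pi * k * y))
      (Real.cos (Real.pi * k * y) * (Real.pi * k)) y := by
    simpa using ((hasDerivAt_id y).const_mul (Real.pi * k)).sin
  have hd := ((((hst _).comp y l1).mul ((hst _).comp y l2)).mul l3).deriv
  have hd' : deriv (cutoffSine k j) y = _ := hd
  rw [hd']
  simp only [Function.comp]
  set s1 := Real.smoothTransition (J * y - 1)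
  set s2 := Real.smoothTransition (J * (1 - y) - 1)
  set d1 := deriv Real.smoothTransition (J * y - 1) with hd1
  set d2 := deriv Real.smoothTransition (J * (1 - y) - 1) with hd2
  have hs1 : |s1| ≤ 1 := by
    rw [abs_of_nonneg (Real.smoothTransition.nonneg _)]; exact Real.smoothTransition.le_one _
  have hs2 : |s2| ≤ 1 := by
    rw [abs_of_nonneg (Real.smoothTransition.nonneg _)]; exact Real.smoothTransition.le_one _
  have b1 : |d1| * (J * |y|) ≤ M := by
    have := hb (J * y - 1)
    rwa [sub_add_cancel, abs_mul, abs_of_pos hJ0] at this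
  have b2 : |d2| * (J * |1 - y|) ≤ M := by
    have := hb (J * (1 - y) - 1)
    rwa [sub_add_cancel, abs_mul, abs_of_pos hJ0] at this
  have c1 : |Real.sin (Real.pi * k * y)| ≤ Real.pi * k * |y| := by
    refine Real.abs_sin_le_abs.trans ?_
    rw [abs_mul, abs_of_nonneg hpk]
  have c2 := abs_sin_le_mul_abs_one_sub k y
  have t1 : |d1 * J * s2 * Real.sin (Real.pi * k * y)| ≤ Real.pi * k * M := by
    rw [abs_mul, abs_mul, abs_mul, abs_of_pos hJ0]
    calc |d1| * J * |s2| * |Real.sin (Real.pi * k * y)|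
        ≤ |d1| * J * 1 * (Real.pi * k * |y|) := by gcongr
      _ = Real.pi * k * (|d1| * (J * |y|)) := by ring
      _ ≤ _ := by gcongr
  have t2 : |s1 * (d2 * -J) * Real.sin (Real.pi * k * y)| ≤ Real.pi * k * M := by
    rw [abs_mul, abs_mul, abs_mul, abs_neg, abs_of_pos hJ0]
    calc |s1| * (|d2| * J) * |Real.sin (Real.pi * k * y)|
        ≤ 1 * (|d2| * J) * (Real.pi * k * |1 - y|) := by gcongr
      _ = Real.pi * k * (|d2| * (J * |1 - y|)) := by ring
      _ ≤ _ := by gcongr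
  have t3 : |s1 * s2 * (Real.cos (Real.pi * k * y) * (Real.pi * k))| ≤ Real.pi * k := by
    rw [abs_mul, abs_mul, abs_mul, abs_of_nonneg hpk]
    calc |s1| * |s2| * (|Real.cos (Real.pi * k * y)| * (Real.pi * k))
        ≤ 1 * 1 * (1 * (Real.pi * k)) := by gcongr; exact Real.abs_cos_le_one _
      _ = _ := by ring
  have e : (d1 * J * s2 + s1 * (d2 * -J)) * Real.sin (Real.pi * k * y) +
      s1 * s2 * (Real.cos (Real.pi * k * y) * (Real.pi * k)) =
      d1 * J * s2 * Real.sin (Real.pi * k * y) + s1 * (d2 * -J) * Real.sin (Real.pi * k * y) +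
      s1 * s2 * (Real.cos (Real.pi * k * y) * (Real.pi * k)) := by ring
  refine le_trans (le_of_eq ?_) ((abs_add_le _ _).trans (add_le_add ((abs_add_le _ _).trans
    (add_le_add t1 t2)) t3))
  rw [← e]
  rfl

/-- Equality of germs and not only of values, so that the derivatives agree as well. -/
theorem eventually_cutoffSine_eventuallyEq (k : ℕ) {y : ℝ} (hy : y ∈ Set.Ioo (0:ℝ) 1) :
    ∀ᶠ j : ℕ in Filter.atTop,
      cutoffSine k j =ᶠ[nhds y] fun y => Real.sin (Real.pi * k * y) := by
  obtain ⟨h0, h1⟩ := hy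
  set m := min (y / 2) ((1 - y) / 2) with hm
  have hm0 : 0 < m := lt_min (by linarith) (by linarith)
  obtain ⟨j₀, hj₀⟩ := exists_nat_gt (2 / m)
  filter_upwards [Filter.eventually_ge_atTop j₀] with j hj
  have hjm : 2 ≤ ((j:ℝ) + 1) * m := by
    rw [div_lt_iff₀ hm0] at hj₀
    have : (j₀:ℝ) ≤ j := by exact_mod_cast hj
    nlinarith
  have hj0 : (0:ℝ) < (j:ℝ) + 1 := by positivity
  have l1 : m ≤ y / 2 := min_le_left _ _
  have l2 : m ≤ (1 - y) / 2 := min_le_right _ _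
  filter_upwards [Ioo_mem_nhds (show y / 2 < y by linarith)
    (show y < 1 - (1 - y) / 2 by linarith)] with z hz
  unfold cutoffSine
  rw [Real.smoothTransition.one_of_one_le, Real.smoothTransition.one_of_one_le, one_mul, one_mul]
  · have : m ≤ 1 - z := by linarith [hz.2]
    nlinarith
  · have : m ≤ z := by linarith [hz.1]
    nlinarith

theorem isTestFunction_prodFun_cutoffSine {n : ℕ} (κ : Fin n → ℕ) (j : ℕ) :
    IsTestFunction (openUnitCube n) (prodFun fun i => cutoffSine (κ i) j) := by
  set I := Set.Icc (1 / ((j:ℝ) + 1)) (1 - 1 / ((j:ℝ) + 1)) with hI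
  set S : Set (EuclideanSpace ℝ (Fin n)) := WithLp.ofLp ⁻¹' (Set.univ.pi fun _ : Fin n => I)
    with hS
  have hSc : IsCompact S :=
    (PiLp.homeomorph 2 (fun _ : Fin n => ℝ)).isCompact_preimage.2
      (isCompact_univ_pi fun _ => isCompact_Icc)
  have hzero : ∀ x ∉ S, prodFun (fun i => cutoffSine (κ i) j) x = 0 := by
    intro x hx
    have : ∃ i, x i ∉ I := by
      by_contra! h
      exact hx fun i _ => h i
    obtain ⟨i, hi⟩ := this
    exact Finset.prod_eq_zero (Finset.mem_univ i) (cutoffSine_eq_zero hi)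
  refine ⟨contDiff_prodFun fun i => contDiff_cutoffSine _ _, HasCompactSupport.intro hSc hzero, ?_⟩
  have hsub : tsupport (prodFun fun i => cutoffSine (κ i) j) ⊆ S :=
    closure_minimal (fun x hx => by by_contra h; exact hx (hzero x h)) hSc.isClosed
  refine hsub.trans fun x hx i => ?_
  have hj : (0:ℝ) < 1 / ((j:ℝ) + 1) := by positivity
  have := hx i (Set.mem_univ i)
  exact ⟨hj.trans_le this.1, this.2.trans_lt (by linarith)⟩

theorem norm_gradient_prodFun_le {n : ℕ} {h : Fin n → ℝ → ℝ} (hh : ∀ i, Differentiable ℝ (h i))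
    {x : EuclideanSpace ℝ (Fin n)} {C : ℝ} (hC : 0 ≤ C) (h1 : ∀ i, |h i (x i)| ≤ 1)
    (h2 : ∀ i, |deriv (h i) (x i)| ≤ C) : ‖gradient (prodFun h) x‖ ≤ n * C := by
  refine norm_le_of_abs_apply_le hC fun i => ?_
  rw [gradient_apply, fderiv_prodFun_single hh]
  refine (abs_prodFun_le (C := Function.update (fun _ => 1) i C) fun j => ?_).trans ?_
  · by_cases hj : j = i
    · subst hj; simpa using h2 j
    · simpa [hj] using h1 j
  · rw [Finset.prod_update_of_mem (Finset.mem_univ i)]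
    simp

theorem norm_gradient_sineFun_le {n : ℕ} (κ : Fin n → ℕ) :
    ∃ C : ℝ, ∀ x, ‖gradient (sineFun κ) x‖ ≤ C := by
  refine ⟨n * (Real.pi * ∑ i, (κ i : ℝ)), fun x => norm_gradient_prodFun_le
    (fun i => by fun_prop) (by positivity) (fun i => Real.abs_sin_le_one _) fun i => ?_⟩
  rw [deriv_sin_mul, abs_mul, abs_of_nonneg (by positivity)]
  have : (κ i : ℝ) ≤ ∑ i, (κ i : ℝ) :=
    Finset.single_le_sum (f := fun i => (κ i : ℝ)) (fun _ _ => Nat.cast_nonneg _)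
      (Finset.mem_univ i)
  calc _ ≤ Real.pi * κ i * 1 := by gcongr; exact Real.abs_cos_le_one _
    _ ≤ _ := by rw [mul_one]; gcongr

theorem abs_sineFun_le {n : ℕ} (κ : Fin n → ℕ) (x : EuclideanSpace ℝ (Fin n)) :
    |sineFun κ x| ≤ 1 := abs_sineMode_le κ _

/-- The Dirichlet eigenfunctions of the cube belong to `H₀¹`. -/
theorem isH01WithGradient_sineFun {n : ℕ} (κ : Fin n → ℕ) :
    IsH01WithGradient (openUnitCube n) (sineFun κ) (gradient (sineFun κ)) := by
  obtain ⟨C, hC⟩ := norm_gradient_sineFun_le κ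
  have hc : Continuous (sineFun κ) := (contDiff_sineFun κ (m := 1)).continuous
  have hg : Continuous (gradient (sineFun κ)) := continuous_gradient (contDiff_sineFun κ)
  choose D hD0 hD using fun i => exists_deriv_cutoffSine_bound (κ i)
  have hDs : ∀ i, D i ≤ ∑ i, D i := fun i =>
    Finset.single_le_sum (fun i _ => hD0 i) (Finset.mem_univ i)
  have hcd : ∀ i j, Differentiable ℝ (cutoffSine (κ i) j) := fun i j =>
    (contDiff_cutoffSine (κ i) j).differentiable (by simp)
  have hloc : ∀ᵐ x ∂(volume.restrict (openUnitCube n)), ∀ᶠ j : ℕ in Filter.atTop, ∀ i,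
      cutoffSine (κ i) j =ᶠ[nhds (x i)] fun y => Real.sin (Real.pi * κ i * y) := by
    filter_upwards [ae_restrict_mem (isOpen_openUnitCube n).measurableSet] with x hx
    rw [Filter.eventually_all]
    exact fun i => eventually_cutoffSine_eventuallyEq (κ i) (hx i)
  have htest := isTestFunction_prodFun_cutoffSine κ
  refine ⟨MemLp.of_bound hc.aestronglyMeasurable 1 (Filter.Eventually.of_forall fun x =>
      abs_sineFun_le κ x), MemLp.of_bound hg.aestronglyMeasurable C
      (Filter.Eventually.of_forall hC), hasWeakGradient_of_contDiff _ (contDiff_sineFun κ),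
    fun j => prodFun fun i => cutoffSine (κ i) j, htest, ?_, ?_⟩
  · refine tendsto_eLpNorm_two_zero_of_bounded (C := 1 + 1)
      (fun j => ((htest j).1.continuous.sub hc).aestronglyMeasurable) (fun j x => ?_) ?_
    · refine (norm_sub_le _ _).trans (add_le_add ?_ (abs_sineFun_le κ x))
      simpa using abs_prodFun_le (h := fun i => cutoffSine (κ i) j) (x := x) (C := fun _ => 1)
        fun i => abs_cutoffSine_le _ _ _
    · filter_upwards [hloc] with x hx
      filter_upwards [hx] with j hj
      rw [sub_eq_zero]
      exact Finset.prod_congr rfl fun i _ => (hj i).self_of_nhds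
  · refine tendsto_eLpNorm_two_zero_of_bounded (C := n * (∑ i, D i) + C)
      (fun j => ((continuous_gradient (htest j).contDiff_one).sub hg).aestronglyMeasurable)
      (fun j x => ?_) ?_
    · refine (norm_sub_le _ _).trans (add_le_add ?_ (hC x))
      exact norm_gradient_prodFun_le (fun i => hcd i j) (Finset.sum_nonneg fun i _ => hD0 i)
        (fun i => abs_cutoffSine_le _ _ _) fun i => (hD i j _).trans (hDs i)
    · filter_upwards [hloc] with x hx
      filter_upwards [hx] with j hj
      rw [sub_eq_zero]
      ext i
      rw [gradient_apply, gradient_apply, sineFun, fderiv_prodFun_single (fun i => hcd i j),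
        fderiv_prodFun_single (fun i => by fun_prop)]
      refine Finset.prod_congr rfl fun l _ => ?_
      by_cases hl : l = i
      · subst hl
        rw [Function.update_self, Function.update_self]
        exact (hj l).deriv_eq
      · rw [Function.update_of_ne hl, Function.update_of_ne hl]
        exact (hj l).self_of_nhds

/-- Green's formula in `H₀¹` against a Dirichlet eigenfunction. -/
theorem IsH01WithGradient.integral_inner_gradient_sineFun {n : ℕ} (κ : Fin n → ℕ)
    {f : EuclideanSpace ℝ (Fin n) → ℝ} {g : EuclideanSpace ℝ (Fin n) → EuclideanSpace ℝ (Fin n)}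
    (hf : IsH01WithGradient (openUnitCube n) f g) :
    ∫ x in openUnitCube n, inner ℝ (g x) (gradient (sineFun κ) x) =
      sineFreq κ * ∫ x in openUnitCube n, f x * sineFun κ x := by
  obtain ⟨hf2, hg2, -, ψ, hψ, hl1, hl2⟩ := hf
  obtain ⟨C, hC⟩ := norm_gradient_sineFun_le κ
  have hc : Continuous (sineFun κ) := (contDiff_sineFun κ (m := 1)).continuous
  have hg : Continuous (gradient (sineFun κ)) := continuous_gradient (contDiff_sineFun κ)
  have hψL : ∀ j, MemLp (ψ j) 2 (volume.restrict (openUnitCube n)) := fun j =>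
    ((hψ j).1.continuous.memLp_of_hasCompactSupport (hψ j).2.1).restrict _
  have hψG : ∀ j, MemLp (gradient (ψ j)) 2 (volume.restrict (openUnitCube n)) := fun j => by
    refine MemLp.restrict _ ((continuous_gradient
      (hψ j).contDiff_one).memLp_of_hasCompactSupport ?_)
    refine (hψ j).2.1.mono' fun x hx => ?_
    by_contra hx'
    exact hx (gradient_eq_zero_of_eventuallyEq (notMem_tsupport_iff_eventuallyEq.1 hx'))
  have t1 := tendsto_integral_inner_of_eLpNorm hψG hg2 hg.aestronglyMeasurable
    (Filter.Eventually.of_forall hC) hl2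
  have t2 := tendsto_integral_inner_of_eLpNorm hψL hf2 hc.aestronglyMeasurable
    (Filter.Eventually.of_forall (abs_sineFun_le κ)) hl1
  simp only [RCLike.inner_apply, conj_trivial] at t2
  simp_rw [_root_.integral_inner_gradient_sineFun _ κ (hψ _), mul_comm (ψ _ _)] at t1
  rw [tendsto_nhds_unique t1 (t2.const_mul _)]
  simp_rw [mul_comm (f _)]

/-! ### Exponential decay of the coefficients of a weak solution -/

/-- A mean-zero test function on an interval is the derivative of a test function. -/
theorem exists_isTestFunction_deriv_eq {T : ℝ} {θ : ℝ → ℝ} (hθ : IsTestFunction (Set.Ioo 0 T) θ)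
    (h0 : ∫ t, θ t = 0) : ∃ ζ, IsTestFunction (Set.Ioo 0 T) ζ ∧ deriv ζ = θ := by
  obtain ⟨hs, hc, hsub⟩ := hθ
  rcases (tsupport θ).eq_empty_or_nonempty with he | hne
  · have : θ = 0 := by
      rw [tsupport_eq_empty_iff] at he; exact he
    refine ⟨0, ⟨contDiff_const, HasCompactSupport.zero, by simp⟩, ?_⟩
    rw [this]
    exact deriv_const' 0
  obtain ⟨a, ha, hal⟩ := hc.isCompact.exists_isLeast hne
  obtain ⟨b, hb, hbl⟩ := hc.isCompact.exists_isGreatest hne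
  have hzero : ∀ t, t ∉ Set.Icc a b → θ t = 0 := by
    intro t ht
    by_contra h
    have hm := subset_tsupport θ h
    exact ht ⟨hal hm, hbl hm⟩
  have hcont := hs.continuous
  set ζ : ℝ → ℝ := fun t => ∫ s in a..t, θ s with hζ
  have hd : ∀ t, HasDerivAt ζ (θ t) t := fun t =>
    intervalIntegral.integral_hasDerivAt_right (hcont.intervalIntegrable _ _)
      hcont.stronglyMeasurable.stronglyMeasurableAtFilter hcont.continuousAt
  have hder : deriv ζ = θ := funext fun t => (hd t).deriv
  -- To the right of the support the primitive equals the full integral, which is zero by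
  -- hypothesis.
  have hζ0 : ∀ t, t ∉ Set.Icc a b → ζ t = 0 := by
    intro t ht
    rw [Set.mem_Icc, not_and_or, not_le, not_le] at ht
    rcases ht with ht | ht
    · rw [hζ]
      simp only
      rw [intervalIntegral.integral_symm, intervalIntegral.integral_of_le ht.le,
        integral_Ioc_eq_integral_Ioo]
      rw [setIntegral_eq_zero_of_forall_eq_zero (fun s hs' => hzero s fun h => by
        linarith [hs'.2, h.1]), neg_zero]
    · rw [hζ]
      simp only
      have hab : a ≤ b := hal hb
      rw [intervalIntegral.integral_of_le (by linarith), ← integral_Icc_eq_integral_Ioc,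
        setIntegral_eq_integral_of_forall_compl_eq_zero, h0]
      intro s hs'
      exact hzero s fun h => hs' ⟨h.1, h.2.trans ht.le⟩
  refine ⟨ζ, ⟨?_, HasCompactSupport.intro isCompact_Icc hζ0, ?_⟩, hder⟩
  · rw [contDiff_infty_iff_deriv]
    exact ⟨fun t => (hd t).differentiableAt, by rw [hder]; exact hs⟩
  · have : tsupport ζ ⊆ Set.Icc a b :=
      closure_minimal (fun t ht => by by_contra h; exact ht (hζ0 t h)) isClosed_Icc
    exact this.trans fun t ht => ⟨(hsub ha).1.trans_le ht.1, ht.2.trans_lt (hsub hb).2⟩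

theorem ContinuousOn.integrableOn_Ioo_mul {T : ℝ} {B : ℝ → ℝ}
    (hB : ContinuousOn B (Set.Icc 0 T)) {f : ℝ → ℝ} (hf : Continuous f) :
    IntegrableOn (fun t => B t * f t) (Set.Ioo 0 T) :=
  ((hB.mul hf.continuousOn).integrableOn_compact isCompact_Icc).mono_set Set.Ioo_subset_Icc_self

/-- The du Bois-Reymond lemma. -/
theorem eq_of_integral_mul_deriv_eq_zero {T : ℝ} (hT : 0 < T) {B : ℝ → ℝ}
    (hB : ContinuousOn B (Set.Icc 0 T))
    (h : ∀ ζ, IsTestFunction (Set.Ioo 0 T) ζ → ∫ t in Set.Ioo 0 T, B t * deriv ζ t = 0) :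
    ∀ t ∈ Set.Icc 0 T, B t = B 0 := by
  let bump : ContDiffBump (T / 2) := ⟨T / 8, T / 4, by positivity, by linarith⟩
  set ρ : ℝ → ℝ := bump.normed volume with hρ
  have hρt : IsTestFunction (Set.Ioo 0 T) ρ := by
    refine ⟨bump.contDiff_normed, bump.hasCompactSupport_normed, ?_⟩
    rw [hρ, bump.tsupport_normed_eq, Real.closedBall_eq_Icc]
    intro t ht
    have h1 : T / 2 - T / 4 ≤ t := ht.1
    have h2 : t ≤ T / 2 + T / 4 := ht.2
    exact ⟨by linarith, by linarith⟩
  have hρ1 : ∫ t, ρ t = 1 := bump.integral_normed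
  set c := ∫ t in Set.Ioo 0 T, B t * ρ t with hcdef
  -- Subtracting (∫ψ)·ρ makes ψ mean-zero, hence a derivative of a test function. This identifies
  -- `B` with the constant c as a distribution.
  have key : ∀ ψ, IsTestFunction (Set.Ioo 0 T) ψ →
      ∫ t in Set.Ioo 0 T, B t * ψ t = c * ∫ t, ψ t := by
    intro ψ hψ
    have hψi : Integrable ψ := hψ.1.continuous.integrable_of_hasCompactSupport hψ.2.1
    have hρi : Integrable ρ := hρt.1.continuous.integrable_of_hasCompactSupport hρt.2.1
    obtain ⟨ζ, hζ, hd⟩ := exists_isTestFunction_deriv_eq (T := T)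
      (θ := fun t => ψ t - (∫ s, ψ s) * ρ t) (by
        refine ⟨hψ.1.sub (contDiff_const.mul hρt.1), hψ.2.1.sub (hρt.2.1.mul_left), ?_⟩
        refine (tsupport_sub _ _).trans (Set.union_subset hψ.2.2 ?_)
        exact (tsupport_mul_subset_right).trans hρt.2.2) (by
        rw [integral_sub hψi (hρi.const_mul _), integral_const_mul, hρ1, mul_one, sub_self])
    have := h ζ hζ
    rw [hd] at this
    have e : ∀ t, B t * (ψ t - (∫ s, ψ s) * ρ t) = B t * ψ t - (∫ s, ψ s) * (B t * ρ t) :=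
      fun t => by ring
    simp_rw [e] at this
    rw [integral_sub (ContinuousOn.integrableOn_Ioo_mul hB hψ.1.continuous)
      ((ContinuousOn.integrableOn_Ioo_mul hB hρt.1.continuous).const_mul _),
      integral_const_mul, ← hcdef] at this
    linarith
  have hae : ∀ᵐ t, t ∈ Set.Ioo 0 T → B t - c = 0 := by
    refine isOpen_Ioo.ae_eq_zero_of_integral_contDiff_smul_eq_zero
      (((hB.mono Set.Ioo_subset_Icc_self).sub continuousOn_const).locallyIntegrableOn
        measurableSet_Ioo) fun ψ h1 h2 h3 => ?_
    have hψ : IsTestFunction (Set.Ioo 0 T) ψ := ⟨h1, h2, h3⟩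
    have hψi : Integrable ψ := h1.continuous.integrable_of_hasCompactSupport h2
    have hz : ∀ t ∉ Set.Ioo 0 T, ψ t = 0 := fun t ht =>
      image_eq_zero_of_notMem_tsupport fun h => ht (h3 h)
    rw [← setIntegral_eq_integral_of_forall_compl_eq_zero (s := Set.Ioo 0 T) (fun t ht => by
      rw [hz t ht, zero_smul])]
    have e : ∀ t, ψ t • (B t - c) = B t * ψ t - c * ψ t := fun t => by
      rw [smul_eq_mul]; ring
    simp_rw [e]
    rw [integral_sub (ContinuousOn.integrableOn_Ioo_mul hB h1.continuous)
      (hψi.const_mul _).integrableOn, integral_const_mul, key ψ hψ,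
      setIntegral_eq_integral_of_forall_compl_eq_zero hz, sub_self]
  have hIoo : Set.EqOn B (fun _ => c) (Set.Ioo 0 T) := by
    refine Measure.eqOn_open_of_ae_eq (μ := volume) ?_ isOpen_Ioo
      (hB.mono Set.Ioo_subset_Icc_self) continuousOn_const
    rw [Filter.EventuallyEq, ae_restrict_iff' measurableSet_Ioo]
    filter_upwards [hae] with t ht htm
    linarith [ht htm]
  have hIcc : Set.EqOn B (fun _ => c) (Set.Icc 0 T) := by
    refine hIoo.of_subset_closure hB continuousOn_const Set.Ioo_subset_Icc_self ?_
    rw [closure_Ioo hT.ne]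
  intro t ht
  rw [hIcc ht, hIcc ⟨le_rfl, hT.le⟩]

theorem IsHeatSolution.continuousOn_coeff {n : ℕ} {T : ℝ} {u₀ : EuclideanSpace ℝ (Fin n) → ℝ}
    {u : ℝ → EuclideanSpace ℝ (Fin n) → ℝ} (hu : IsHeatSolution (openUnitCube n) T u₀ u)
    (κ : Fin n → ℕ) :
    ContinuousOn (fun t => ∫ x in openUnitCube n, u t x * sineFun κ x) (Set.Icc 0 T) := by
  intro t ht
  have hc : Continuous (sineFun κ) := (contDiff_sineFun κ (m := 1)).continuous
  have hl := hu.continuous_L2 t ht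
  rw [ContinuousWithinAt, tendsto_nhdsWithin_iff_subtype ht]
  rw [tendsto_nhdsWithin_iff_subtype ht] at hl
  have := tendsto_integral_inner_of_eLpNorm (F := fun s : Set.Icc 0 T => u s)
    (fun s => hu.memLp s s.2) (hu.memLp t ht) hc.aestronglyMeasurable
    (Filter.Eventually.of_forall (abs_sineFun_le κ)) hl
  simp only [RCLike.inner_apply, conj_trivial, mul_comm (sineFun κ _)] at this
  exact this

/-- The sine coefficients of a weak solution decay exponentially. -/
theorem IsHeatSolution.coeff_eq {n : ℕ} {T : ℝ} (hT : 0 < T)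
    {u₀ : EuclideanSpace ℝ (Fin n) → ℝ} {u : ℝ → EuclideanSpace ℝ (Fin n) → ℝ}
    (hu : IsHeatSolution (openUnitCube n) T u₀ u) (κ : Fin n → ℕ) {t : ℝ}
    (ht : t ∈ Set.Icc 0 T) :
    ∫ x in openUnitCube n, u t x * sineFun κ x =
      Real.exp (-(sineFreq κ * t)) * ∫ x in openUnitCube n, u 0 x * sineFun κ x := by
  set A : ℝ → ℝ := fun t => ∫ x in openUnitCube n, u t x * sineFun κ x with hA
  have hAc : ContinuousOn A (Set.Icc 0 T) := hu.continuousOn_coeff κ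
  obtain ⟨g, -, -, hH, heq⟩ := hu.weak_equation
  have hweak : ∀ η, IsTestFunction (Set.Ioo 0 T) η →
      ∫ t in Set.Ioo 0 T, A t * deriv η t = ∫ t in Set.Ioo 0 T, sineFreq κ * A t * η t := by
    intro η hη
    rw [hA, heq _ _ (isH01WithGradient_sineFun κ) η hη]
    refine integral_congr_ae ?_
    filter_upwards [hH] with t ht
    rw [ht.integral_inner_gradient_sineFun κ]
  have hE : ContDiff ℝ ((⊤ : ℕ∞) : WithTop ℕ∞) fun t : ℝ => Real.exp (sineFreq κ * t) := by
    fun_prop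
  -- Integrating factor: A' = -λA holds weakly, so exp(λt)·A(t) has zero weak derivative. This is
  -- checked by testing the equation for `A` with exp(λt)·ζ.
  have hconst := eq_of_integral_mul_deriv_eq_zero hT
    (B := fun t => Real.exp (sineFreq κ * t) * A t)
    (hE.continuous.continuousOn.mul hAc) fun ζ hζ => by
      set η : ℝ → ℝ := fun t => Real.exp (sineFreq κ * t) * ζ t with hη
      have hηt : IsTestFunction (Set.Ioo 0 T) η :=
        ⟨hE.mul hζ.1, hζ.2.1.mul_left, tsupport_mul_subset_right.trans hζ.2.2⟩
      have hd : ∀ t, deriv η t =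
          sineFreq κ * η t + Real.exp (sineFreq κ * t) * deriv ζ t := by
        intro t
        have h1 : HasDerivAt (fun t : ℝ => Real.exp (sineFreq κ * t))
            (Real.exp (sineFreq κ * t) * sineFreq κ) t := by
          simpa using ((hasDerivAt_id t).const_mul (sineFreq κ)).exp
        have h2 := (hζ.contDiff_one.differentiable one_ne_zero t).hasDerivAt
        have h3 : deriv η t = _ := (h1.mul h2).deriv
        rw [h3, hη]
        ring
      have hηd : Continuous (deriv η) := hηt.contDiff_one.continuous_deriv le_rfl
      have e : ∀ t, Real.exp (sineFreq κ * t) * A t * deriv ζ t =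
          A t * deriv η t - sineFreq κ * A t * η t := by
        intro t; rw [hd]; ring
      simp_rw [e]
      rw [integral_sub (ContinuousOn.integrableOn_Ioo_mul hAc hηd)
        (ContinuousOn.integrableOn_Ioo_mul (B := fun t => sineFreq κ * A t)
          (continuousOn_const.mul hAc) hηt.1.continuous), hweak η hηt, sub_self]
  have := hconst t ht
  simp only [mul_zero, Real.exp_zero, one_mul] at this
  change A t = _ * A 0
  rw [← this, ← mul_assoc, ← Real.exp_add, neg_add_cancel, Real.exp_zero, one_mul]

/-! ### Completeness of the sine system -/

/-- The product-to-sum formula: multiplication by cos(πx_i) maps sines to combinations of sines, so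
orthogonality to all sines is preserved by it. -/
theorem sineFun_mul_cos {n : ℕ} (κ : Fin n → ℕ) (i : Fin n) (hi : κ i ≠ 0)
    (x : EuclideanSpace ℝ (Fin n)) :
    sineFun κ x * Real.cos (Real.pi * x i) =
      (sineFun (Function.update κ i (κ i + 1)) x + sineFun (Function.update κ i (κ i - 1)) x) / 2 := by
  have hsplit : ∀ m : ℕ, sineFun (Function.update κ i m) x =
      Real.sin (Real.pi * m * x i) *
        ∏ j ∈ Finset.univ.erase i, Real.sin (Real.pi * κ j * x j) := by
    intro m
    rw [sineFun, prodFun, ← Finset.mul_prod_erase _ _ (Finset.mem_univ i), Function.update_self]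
    congr 1
    exact Finset.prod_congr rfl fun j hj => by
      rw [Function.update_of_ne (Finset.ne_of_mem_erase hj)]
  have h0 := hsplit (κ i)
  rw [Function.update_eq_self] at h0
  rw [h0, hsplit, hsplit, Nat.cast_sub (Nat.one_le_iff_ne_zero.2 hi)]
  have e1 : Real.pi * ((κ i + 1 : ℕ) : ℝ) * x i = Real.pi * κ i * x i + Real.pi * x i := by
    push_cast; ring
  have e2 : Real.pi * ((κ i : ℝ) - (1 : ℕ)) * x i = Real.pi * κ i * x i - Real.pi * x i := by
    push_cast; ring
  rw [e1, e2, Real.sin_add, Real.sin_sub]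
  ring

/-- The closed unit cube. -/
def closedUnitCube (n : ℕ) : Set (EuclideanSpace ℝ (Fin n)) :=
  {x | ∀ i, x i ∈ Set.Icc (0 : ℝ) 1}

theorem isCompact_closedUnitCube (n : ℕ) : IsCompact (closedUnitCube n) := by
  have : closedUnitCube n =
      (PiLp.homeomorph 2 (fun _ : Fin n => ℝ)) ⁻¹' (Set.univ.pi fun _ => Set.Icc 0 1) := by
    ext x
    simp only [closedUnitCube, Set.mem_preimage, Set.mem_univ_pi]
    rfl
  rw [this]
  exact (PiLp.homeomorph 2 (fun _ : Fin n => ℝ)).isCompact_preimage.2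
    (isCompact_univ_pi fun _ => isCompact_Icc)

theorem openUnitCube_subset_closedUnitCube (n : ℕ) : openUnitCube n ⊆ closedUnitCube n :=
  fun _ hx i => Set.Ioo_subset_Icc_self (hx i)

/-- The Dirichlet eigenfunctions of the cube are complete. -/
theorem ae_eq_zero_of_integral_mul_sineFun_eq_zero {n : ℕ} {f : EuclideanSpace ℝ (Fin n) → ℝ}
    (hf : IntegrableOn f (openUnitCube n))
    (h : ∀ κ, ∫ x in openUnitCube n, f x * sineFun κ x = 0) :
    f =ᵐ[volume.restrict (openUnitCube n)] 0 := by
  set Ω := openUnitCube n with hΩ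
  have hΩo : IsOpen Ω := isOpen_openUnitCube n
  have hΩm : MeasurableSet Ω := hΩo.measurableSet
  set S := closedUnitCube n with hS
  have hSm : MeasurableSet S := (isCompact_closedUnitCube n).isClosed.measurableSet
  have hΩS : Ω ⊆ S := openUnitCube_subset_closedUnitCube n
  have : CompactSpace S := isCompact_iff_compactSpace.1 (isCompact_closedUnitCube n)
  set μ : Measure S := Measure.comap Subtype.val volume with hμ
  have hsub : ∀ F : EuclideanSpace ℝ (Fin n) → ℝ,
      ∫ x : S, Ω.indicator F x ∂μ = ∫ x in Ω, F x := by
    intro F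
    rw [hμ, integral_subtype_comap hSm (Ω.indicator F), setIntegral_indicator hΩm,
      Set.inter_eq_right.2 hΩS]
  have hsin : ∀ κ : Fin n → ℕ, Continuous (sineFun κ) := fun κ =>
    (contDiff_sineFun κ (m := 1)).continuous
  -- Stone-Weierstrass needs the compact closed cube, whereas f is controlled only on the open one;
  -- the indicator reconciles the two.
  set G : (Fin n → ℕ) → EuclideanSpace ℝ (Fin n) → ℝ :=
    fun κ => Ω.indicator fun x => f x * sineFun κ x with hG
  have hGi : ∀ κ, Integrable (fun x : S => G κ x) μ := by
    intro κ
    have h1 : IntegrableOn (fun x => f x * sineFun κ x) Ω :=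
      hf.mul_bdd (c := 1) (hsin κ).aestronglyMeasurable
        (Filter.Eventually.of_forall (abs_sineFun_le κ))
    have h2 : IntegrableOn (G κ) S := (h1.integrable_indicator hΩm).integrableOn
    rw [integrableOn_iff_comap_subtypeVal hSm] at h2
    exact h2
  have hbdd : ∀ (κ) (a : C(S, ℝ)), Integrable (fun x : S => G κ x * a x) μ := fun κ a =>
    (hGi κ).mul_bdd (c := ‖a‖) a.continuous.aestronglyMeasurable
      (Filter.Eventually.of_forall fun x => a.norm_coe_le_norm x)
  set Φ : (Fin n → ℕ) → C(S, ℝ) → ℝ := fun κ a => ∫ x, G κ x * a x ∂μ with hΦ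
  -- The continuous a for which f·a is still orthogonal to every sine. It is closed, contains 1, and
  -- is stable under multiplication by the algebra generated by the cos(πx_i), which is dense since
  -- these separate points of the cube. Hence V is everything.
  set V : Set C(S, ℝ) := {a | ∀ κ, Φ κ a = 0} with hV
  have hΦc : ∀ κ, Continuous (Φ κ) := by
    intro κ
    refine LipschitzWith.continuous (K := Real.toNNReal (∫ x, ‖G κ x‖ ∂μ))
      (LipschitzWith.of_dist_le_mul fun a b => ?_)
    rw [Real.coe_toNNReal _ (integral_nonneg fun _ => norm_nonneg _), dist_eq_norm, dist_eq_norm,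
      hΦ]
    simp only
    rw [← integral_sub (hbdd κ a) (hbdd κ b), ← integral_mul_const]
    refine norm_integral_le_of_norm_le ((hGi κ).norm.mul_const _)
      (Filter.Eventually.of_forall fun x => ?_)
    rw [← mul_sub, norm_mul]
    gcongr
    exact (a - b).norm_coe_le_norm x
  have hVc : IsClosed V := by
    have : V = ⋂ κ, Φ κ ⁻¹' {0} := by ext a; simp [hV]
    rw [this]
    exact isClosed_iInter fun κ => isClosed_singleton.preimage (hΦc κ)
  set c : Fin n → C(S, ℝ) := fun i => ⟨fun x => Real.cos (Real.pi * (x : EuclideanSpace ℝ (Fin n)) i),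
    by fun_prop⟩ with hc
  set A : Subalgebra ℝ C(S, ℝ) := Algebra.adjoin ℝ (Set.range c) with hA
  have hmul : ∀ a ∈ A, ∀ b ∈ V, a * b ∈ V := by
    intro a ha
    induction ha using Algebra.adjoin_induction with
    | mem a ha =>
      obtain ⟨i, rfl⟩ := ha
      intro b hb κ
      by_cases hi : κ i = 0
      · have : ∀ x, G κ x = 0 := by
          intro x
          simp only [hG, Set.indicator_apply_eq_zero]
          intro _
          rw [sineFun_apply, sineMode_eq_zero ⟨i, hi⟩, mul_zero]
        simp [hΦ, this]
      · have e : ∀ x : S, G κ x * (c i * b) x =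
            (1 / 2) * (G (Function.update κ i (κ i + 1)) x * b x +
              G (Function.update κ i (κ i - 1)) x * b x) := by
          intro x
          rw [ContinuousMap.mul_apply]
          by_cases hx : (x : EuclideanSpace ℝ (Fin n)) ∈ Ω
          · simp only [hG, Set.indicator_of_mem hx, hc, ContinuousMap.coe_mk]
            linear_combination (f x * b x) * sineFun_mul_cos κ i hi (x : EuclideanSpace ℝ (Fin n))
          · simp [hG, Set.indicator_of_notMem hx]
        simp only [hΦ]
        simp_rw [e]
        rw [integral_const_mul, integral_add (hbdd _ b) (hbdd _ b)]
        have h1 := hb (Function.update κ i (κ i + 1))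
        have h2 := hb (Function.update κ i (κ i - 1))
        simp only [hΦ] at h1 h2
        rw [h1, h2]; simp
    | algebraMap r =>
      intro b hb κ
      have e : ∀ x : S, G κ x * (algebraMap ℝ C(S, ℝ) r * b) x = r * (G κ x * b x) := by
        intro x
        rw [Algebra.algebraMap_eq_smul_one, smul_mul_assoc, one_mul, ContinuousMap.smul_apply,
          smul_eq_mul]
        ring
      simp only [hΦ]
      simp_rw [e]
      rw [integral_const_mul]
      have h1 := hb κ
      simp only [hΦ] at h1
      rw [h1, mul_zero]
    | add a b _ _ iha ihb =>
      intro d hd κ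
      have e : ∀ x : S, G κ x * ((a + b) * d) x = G κ x * (a * d) x + G κ x * (b * d) x := by
        intro x
        simp only [ContinuousMap.mul_apply, ContinuousMap.add_apply]
        ring
      simp only [hΦ]
      simp_rw [e]
      rw [integral_add (hbdd κ (a * d)) (hbdd κ (b * d))]
      have h1 := iha d hd κ
      have h2 := ihb d hd κ
      simp only [hΦ] at h1 h2
      rw [h1, h2, add_zero]
    | mul a b _ _ iha ihb =>
      intro d hd
      rw [mul_assoc]
      exact iha _ (ihb d hd)
  have hone : (1 : C(S, ℝ)) ∈ V := by
    intro κ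
    have := hsub fun x => f x * sineFun κ x
    simp only [hΦ, ContinuousMap.one_apply, mul_one, hG]
    rw [this, h κ]
  have hAV : (A : Set C(S, ℝ)) ⊆ V := fun a ha => by
    have := hmul a ha 1 hone
    rwa [mul_one] at this
  have hsep : A.SeparatesPoints := by
    intro x y hxy
    have : ∃ i, (x : EuclideanSpace ℝ (Fin n)) i ≠ (y : EuclideanSpace ℝ (Fin n)) i := by
      by_contra! hcon
      exact hxy (Subtype.ext (PiLp.ext hcon))
    obtain ⟨i, hi⟩ := this
    refine ⟨c i, ⟨c i, Algebra.subset_adjoin ⟨i, rfl⟩, rfl⟩, fun heq => hi ?_⟩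
    have hx := x.2 i
    have hy := y.2 i
    have := Real.injOn_cos (x₁ := Real.pi * (x : EuclideanSpace ℝ (Fin n)) i)
      (x₂ := Real.pi * (y : EuclideanSpace ℝ (Fin n)) i)
      ⟨mul_nonneg Real.pi_pos.le hx.1, mul_le_of_le_one_right Real.pi_pos.le hx.2⟩
      ⟨mul_nonneg Real.pi_pos.le hy.1, mul_le_of_le_one_right Real.pi_pos.le hy.2⟩ heq
    exact mul_left_cancel₀ Real.pi_ne_zero this
  have htop := ContinuousMap.subalgebra_topologicalClosure_eq_top_of_separatesPoints A hsep
  have hall : ∀ a : C(S, ℝ), a ∈ V := by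
    intro a
    have : a ∈ A.topologicalClosure := by rw [htop]; trivial
    exact closure_minimal hAV hVc this
  -- Only the lowest mode is needed now: it has no zero in the open cube, so it can be divided out.
  have hae : ∀ᵐ x, x ∈ Ω → f x * sineFun (fun _ => 1) x = 0 := by
    refine hΩo.ae_eq_zero_of_integral_contDiff_smul_eq_zero ?_ fun ψ h1 h2 h3 => ?_
    · have h1 : IntegrableOn (fun x => f x * sineFun (fun _ => 1) x) Ω :=
        hf.mul_bdd (c := 1) (hsin _).aestronglyMeasurable
          (Filter.Eventually.of_forall (abs_sineFun_le _))
      exact h1.locallyIntegrableOn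
    · have hz : ∀ x ∉ Ω, ψ x = 0 := fun x hx =>
        image_eq_zero_of_notMem_tsupport fun h => hx (h3 h)
      have hv := hall ⟨fun x => ψ x, h1.continuous.comp continuous_subtype_val⟩ fun _ => 1
      have e := hsub fun x => ψ x • (f x * sineFun (fun _ => 1) x)
      rw [setIntegral_eq_integral_of_forall_compl_eq_zero (fun x hx => by
        rw [hz x hx, zero_smul])] at e
      rw [← e, ← hv]
      refine integral_congr_ae (Filter.Eventually.of_forall fun x => ?_)
      simp only [hG, ContinuousMap.coe_mk]
      by_cases hx : (x : EuclideanSpace ℝ (Fin n)) ∈ Ω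
      · simp only [Set.indicator_of_mem hx, smul_eq_mul]; ring
      · simp [Set.indicator_of_notMem hx]
  rw [Filter.EventuallyEq, ae_restrict_iff' hΩm]
  filter_upwards [hae] with x hx hxΩ
  have hpos : 0 < sineFun (fun _ => 1) x := by
    unfold sineFun prodFun
    refine Finset.prod_pos fun i _ => Real.sin_pos_of_pos_of_lt_pi ?_ ?_
    · have := (hxΩ i).1
      have := Real.pi_pos
      positivity
    · have := (hxΩ i).2
      have := Real.pi_pos
      simp only [Nat.cast_one, mul_one]
      nlinarith
  exact (mul_eq_zero.1 (hx hxΩ)).resolve_right hpos.ne'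

/-! ### Identification of weak solutions with sine series -/

theorem integral_openUnitCube_prodFun {n : ℕ} (h : Fin n → ℝ → ℝ) :
    ∫ x in openUnitCube n, prodFun h x = ∏ i, ∫ y in (0:ℝ)..1, h i y := by
  have hemb : MeasurableEmbedding (WithLp.ofLp : EuclideanSpace ℝ (Fin n) → Fin n → ℝ) :=
    (MeasurableEquiv.toLp 2 (Fin n → ℝ)).symm.measurableEmbedding
  have h1 := (PiLp.volume_preserving_ofLp (Fin n)).setIntegral_preimage_emb hemb
    (fun x : Fin n → ℝ => ∏ i, h i (x i)) (Set.univ.pi fun _ => Set.Ioo (0:ℝ) 1)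
  rw [← openUnitCube_eq_preimage] at h1
  have h2 : ∫ x in openUnitCube n, prodFun h x = _ := h1
  rw [h2, volume_pi, Measure.restrict_pi_pi, integral_fintype_prod_eq_prod]
  refine Finset.prod_congr rfl fun i _ => ?_
  rw [intervalIntegral.integral_of_le zero_le_one, integral_Ioc_eq_integral_Ioo]

theorem integral_sineFun_mul_sineFun {n : ℕ} (κ l : Fin n → ℕ) (hl : ∀ i, l i ≠ 0) :
    ∫ x in openUnitCube n, sineFun κ x * sineFun l x = if κ = l then (1 / 2) ^ n else 0 := by
  have e : ∀ x, sineFun κ x * sineFun l x = prodFun (fun i y =>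
      Real.sin (Real.pi * l i * y) * Real.sin (Real.pi * κ i * y)) x := by
    intro x
    unfold sineFun prodFun
    rw [← Finset.prod_mul_distrib]
    exact Finset.prod_congr rfl fun i _ => mul_comm _ _
  simp_rw [e]
  rw [integral_openUnitCube_prodFun,
    Finset.prod_congr rfl fun i _ => integral_sin_mul_sin (l i) (κ i) (hl i)]
  split_ifs with h
  · subst h; simp
  · obtain ⟨i, hi⟩ := Function.ne_iff.1 h
    exact Finset.prod_eq_zero (Finset.mem_univ i) (if_neg (Ne.symm hi))

theorem continuous_heatSeries {n : ℕ} {a : (Fin n → ℕ) → ℝ} {M : ℝ} (ha : ∀ κ, |a κ| ≤ M)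
    {t : ℝ} (ht : 0 < t) :
    Continuous fun x : EuclideanSpace ℝ (Fin n) => heatSeries a t x.ofLp := by
  refine continuous_tsum (fun κ => ?_) ((summable_exp_sineFreq n ht).1.mul_left M) fun κ x => ?_
  · exact continuous_const.mul (continuous_const.mul (contDiff_sineFun κ (m := 1)).continuous)
  · simpa using norm_heatSeries_term_le (a := a) (s := 0) (S := M)
      (fun κ => by simpa using ha κ) t x.ofLp κ

/-- Absolute convergence at t > 0 allows termwise integration, and orthogonality keeps only the term
l. -/
theorem integral_heatSeries_mul_sineFun {n : ℕ} {a : (Fin n → ℕ) → ℝ} {M : ℝ}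
    (ha : ∀ κ, |a κ| ≤ M) {t : ℝ} (ht : 0 < t) (l : Fin n → ℕ) (hl : ∀ i, l i ≠ 0) :
    ∫ x in openUnitCube n, heatSeries a t x.ofLp * sineFun l x =
      a l * Real.exp (-(sineFreq l * t)) * (1 / 2) ^ n := by
  set F : (Fin n → ℕ) → EuclideanSpace ℝ (Fin n) → ℝ := fun κ x =>
    a κ * (Real.exp (-(sineFreq κ * t)) * sineMode κ x.ofLp) * sineFun l x with hF
  have hc : ∀ κ : Fin n → ℕ, Continuous (sineFun κ) := fun κ =>
    (contDiff_sineFun κ (m := 1)).continuous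
  have hFc : ∀ κ, Continuous (F κ) := fun κ =>
    (continuous_const.mul (continuous_const.mul (hc κ))).mul (hc l)
  have hFb : ∀ κ x, ‖F κ x‖ ≤ M * Real.exp (-(sineFreq κ * t)) := by
    intro κ x
    have h1 := norm_heatSeries_term_le (a := a) (s := 0) (S := M)
      (fun κ => by simpa using ha κ) t x.ofLp κ
    rw [sub_zero] at h1
    rw [hF, norm_mul]
    exact (mul_le_of_le_one_right (norm_nonneg _) (abs_sineFun_le l x)).trans h1
  have hFi : ∀ κ, Integrable (F κ) (volume.restrict (openUnitCube n)) := fun κ =>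
    Integrable.of_bound (hFc κ).aestronglyMeasurable _ (Filter.Eventually.of_forall (hFb κ))
  have hsum : Summable fun κ => ∫ x in openUnitCube n, ‖F κ x‖ := by
    refine Summable.of_nonneg_of_le (fun κ => integral_nonneg fun _ => norm_nonneg _)
      (fun κ => ?_) ((summable_exp_sineFreq n ht).1.mul_left M)
    refine (integral_mono (hFi κ).norm (integrable_const _) (hFb κ)).trans ?_
    simp
  have h1 := hasSum_integral_of_summable_integral_norm hFi hsum
  have h2 : ∀ κ, ∫ x in openUnitCube n, F κ x =
      if κ = l then a l * Real.exp (-(sineFreq l * t)) * (1 / 2) ^ n else 0 := by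
    intro κ
    have e : ∀ x, F κ x =
        a κ * Real.exp (-(sineFreq κ * t)) * (sineFun κ x * sineFun l x) := by
      intro x; rw [hF, sineFun_apply κ]; ring
    simp_rw [e]
    rw [integral_const_mul, integral_sineFun_mul_sineFun κ l hl]
    split_ifs with h
    · rw [h]
    · rw [mul_zero]
  simp_rw [h2] at h1
  have h3 := h1.unique (hasSum_ite_eq l _)
  rw [← h3]
  refine integral_congr_ae (Filter.Eventually.of_forall fun x => ?_)
  simp only [hF]
  rw [tsum_mul_right]
  rfl

/-- The scaled sine coefficients of the initial value of a heat solution. -/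
noncomputable def sineCoeff {n : ℕ} (f : EuclideanSpace ℝ (Fin n) → ℝ) (κ : Fin n → ℕ) : ℝ :=
  2 ^ n * ∫ x in openUnitCube n, f x * sineFun κ x

theorem abs_sineCoeff_le {n : ℕ} {f : EuclideanSpace ℝ (Fin n) → ℝ}
    (hf : IntegrableOn f (openUnitCube n)) (κ : Fin n → ℕ) :
    |sineCoeff f κ| ≤ 2 ^ n * ∫ x in openUnitCube n, |f x| := by
  unfold sineCoeff
  rw [abs_mul, abs_of_pos (by positivity)]
  refine mul_le_mul_of_nonneg_left ?_ (by positivity)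
  rw [← Real.norm_eq_abs]
  refine norm_integral_le_of_norm_le hf.norm
    (Filter.Eventually.of_forall fun x => ?_)
  rw [norm_mul]
  exact mul_le_of_le_one_right (norm_nonneg _) (abs_sineFun_le κ x)

theorem sineCoeff_eq_zero {n : ℕ} (f : EuclideanSpace ℝ (Fin n) → ℝ) {κ : Fin n → ℕ}
    (h : ∃ i, κ i = 0) : sineCoeff f κ = 0 := by
  unfold sineCoeff
  simp_rw [sineFun_apply, sineMode_eq_zero h]
  simp

/-- A weak solution equals its sine series at positive times. -/
theorem IsHeatSolution.eq_heatSeries {n : ℕ} {T : ℝ} (hT : 0 < T)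
    {u₀ : EuclideanSpace ℝ (Fin n) → ℝ} {u : ℝ → EuclideanSpace ℝ (Fin n) → ℝ}
    (hu : IsHeatSolution (openUnitCube n) T u₀ u) {t : ℝ} (ht : t ∈ Set.Ioc 0 T) :
    Set.EqOn (u t) (fun x => heatSeries (sineCoeff (u 0)) t x.ofLp) (openUnitCube n) := by
  have h0 : IntegrableOn (u 0) (openUnitCube n) := (hu.memLp 0 ⟨le_rfl, hT.le⟩).integrable
    one_le_two
  have hti : IntegrableOn (u t) (openUnitCube n) := (hu.memLp t ⟨ht.1.le, ht.2⟩).integrable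
    one_le_two
  have ha := abs_sineCoeff_le h0
  have hc := continuous_heatSeries ha ht.1
  have hUi : IntegrableOn (fun x : EuclideanSpace ℝ (Fin n) =>
      heatSeries (sineCoeff (u 0)) t x.ofLp) (openUnitCube n) :=
    Integrable.of_bound hc.aestronglyMeasurable _ (Filter.Eventually.of_forall fun x =>
      abs_heatSeries_le (s := 0) (fun κ => by simpa using ha κ) ht.1 x.ofLp)
  -- Solution and series have the same coefficients at time t, so they agree almost everywhere;
  -- continuity of both in x upgrades this to every point, which is essential because the
  -- observation set is null.
  have hzero := ae_eq_zero_of_integral_mul_sineFun_eq_zero (hti.sub hUi) fun κ => by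
    by_cases hκ : ∃ i, κ i = 0
    · simp_rw [sineFun_apply, sineMode_eq_zero hκ]
      simp
    push Not at hκ
    have hb : ∀ {f : EuclideanSpace ℝ (Fin n) → ℝ}, IntegrableOn f (openUnitCube n) →
        IntegrableOn (fun x => f x * sineFun κ x) (openUnitCube n) := fun hf =>
      hf.mul_bdd (c := 1) (contDiff_sineFun κ (m := 1)).continuous.aestronglyMeasurable
        (Filter.Eventually.of_forall (abs_sineFun_le κ))
    simp only [Pi.sub_apply, sub_mul]
    rw [integral_sub (hb hti) (hb hUi), hu.coeff_eq hT κ ⟨ht.1.le, ht.2⟩,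
      integral_heatSeries_mul_sineFun ha ht.1 κ hκ, sineCoeff]
    have : (2:ℝ) ^ n * (1 / 2) ^ n = 1 := by rw [← mul_pow]; norm_num
    linear_combination (-(∫ x in openUnitCube n, u 0 x * sineFun κ x) *
      Real.exp (-(sineFreq κ * t))) * this
  refine Measure.eqOn_open_of_ae_eq (μ := volume) ?_ (isOpen_openUnitCube n) ?_ hc.continuousOn
  · filter_upwards [hzero] with x hx
    exact sub_eq_zero.1 hx
  · exact hu.continuousOn.comp (f := fun x => (t, x)) (by fun_prop)
      fun x hx => Set.mk_mem_prod ht hx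

/-! ### The observation set and the conclusion -/

theorem countable_pointTimesOmegaAlpha (n : ℕ) (x₀ α : ℝ) :
    (pointTimesOmegaAlpha n x₀ α).Countable := by
  have h1 : (omegaAlpha α).Countable := by
    refine (Set.countable_range fun i : ℕ => (i : ℝ) ^ (-α)).mono ?_
    rintro y ⟨i, _, rfl⟩
    exact ⟨i, rfl⟩
  have h2 : pointTimesOmegaAlpha n x₀ α = WithLp.ofLp ⁻¹'
      (Set.univ.pi fun i : Fin n => if (i : ℕ) = 0 then {x₀} else omegaAlpha α) := by
    ext x
    simp only [pointTimesOmegaAlpha, Set.mem_preimage, Set.mem_univ_pi]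
    rfl
  rw [h2]
  refine (Set.countable_univ_pi fun i => ?_).preimage (WithLp.ofLp_injective 2)
  split_ifs
  · exact Set.countable_singleton _
  · exact h1

theorem toLp_obsNode_mem {n : ℕ} (hn : 0 < n) {x₀ α : ℝ} (hα : 0 < α)
    (hx₀ : x₀ ∈ Set.Ioo (0 : ℝ) 1) {N : ℕ} (p : Fin n → Fin N) :
    WithLp.toLp 2 (obsNode ⟨0, hn⟩ x₀ α p) ∈ pointTimesOmegaAlpha n x₀ α ∩ openUnitCube n := by
  constructor
  · intro i
    simp only [obsNode]
    by_cases hi : i = ⟨0, hn⟩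
    · have : (i : ℕ) = 0 := by rw [hi]
      simp [hi]
    · have : (i : ℕ) ≠ 0 := fun h => hi (Fin.ext h)
      rw [if_neg hi, if_neg this]
      exact ⟨p i + 2, by omega, rfl⟩
  · intro i
    simp only [obsNode]
    by_cases hi : i = ⟨0, hn⟩
    · rw [if_pos hi]; exact hx₀
    · rw [if_neg hi]
      have h2 : (1:ℝ) < ((p i + 2 : ℕ) : ℝ) := by push_cast; linarith [(p i : ℕ).cast_nonneg (α := ℝ)]
      exact ⟨by positivity, Real.rpow_lt_one_of_one_lt_of_neg h2 (by linarith)⟩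

theorem mainTheorem11 (n : ℕ) (hn : 2 ≤ n) (α : ℝ) (hα : 0 < α) (T : ℝ) (hT : 0 < T)
    (x₀ : ℝ) (hx₀ : x₀ ∈ Set.Ioo (0 : ℝ) 1) (halg : IsAlgebraic ℚ x₀)
    (hdeg : 1 < (minpoly ℚ x₀).natDegree) :
    (pointTimesOmegaAlpha n x₀ α ∩ openUnitCube n).Countable ∧
      HeatObservable (openUnitCube n) (pointTimesOmegaAlpha n x₀ α ∩ openUnitCube n) T := by
  refine ⟨(countable_pointTimesOmegaAlpha n x₀ α).mono Set.inter_subset_left, ?_⟩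
  have hn0 : 0 < n := by omega
  obtain ⟨C, hC, hobs⟩ := exists_heatSeries_observability (⟨0, hn0⟩ : Fin n) hα hT halg hdeg
  refine ⟨C, hC, fun u₀ _ u hu => ?_⟩
  set ω := pointTimesOmegaAlpha n x₀ α ∩ openUnitCube n with hω
  set J := ∫⁻ t in Set.Ioo 0 T, ⨆ x ∈ ω, ‖u t x‖ₑ with hJ
  -- An infinite right-hand side leaves nothing to prove, as C > 0; otherwise `J` is the real number
  -- bounding the observation at each single node.
  by_cases hJtop : J = ⊤
  · rw [hJtop, ENNReal.mul_top (by simpa using hC)]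
    exact le_top
  have h0 : IntegrableOn (u 0) (openUnitCube n) := (hu.memLp 0 ⟨le_rfl, hT.le⟩).integrable
    one_le_two
  have hbound := hobs (sineCoeff (u 0)) _ J.toReal (abs_sineCoeff_le h0)
    (fun κ => sineCoeff_eq_zero (u 0)) (fun N p s t hs hst htT => by
      set y : EuclideanSpace ℝ (Fin n) := WithLp.toLp 2 (obsNode ⟨0, hn0⟩ x₀ α p) with hy
      have hyω : y ∈ ω := toLp_obsNode_mem hn0 hα hx₀ p
      have hmem : ∀ r ∈ Set.Icc s t, r ∈ Set.Ioc 0 T := fun r hr =>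
        ⟨hs.trans_le hr.1, hr.2.trans htT⟩
      have heq : ∀ r ∈ Set.Icc s t,
          heatSeries (sineCoeff (u 0)) r (obsNode ⟨0, hn0⟩ x₀ α p) = u r y := fun r hr =>
        (hu.eq_heatSeries hT (hmem r hr) hyω.2).symm
      have hcont : ContinuousOn (fun r => u r y) (Set.Icc s t) :=
        hu.continuousOn.comp (f := fun r => (r, y)) (by fun_prop) fun r hr =>
          Set.mk_mem_prod (hmem r hr) hyω.2
      have hcont' : ContinuousOn
          (fun r => heatSeries (sineCoeff (u 0)) r (obsNode ⟨0, hn0⟩ x₀ α p)) (Set.Icc s t) :=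
        hcont.congr heq
      refine ⟨hcont'.intervalIntegrable_of_Icc hst, ?_⟩
      have hint : IntegrableOn (fun r => u r y) (Set.Ioc s t) :=
        (hcont.integrableOn_compact isCompact_Icc).mono_set Set.Ioc_subset_Icc_self
      rw [intervalIntegral.integral_of_le hst, setIntegral_congr_fun measurableSet_Ioc
        (g := fun r => ‖u r y‖) fun r hr => by
          simp only [heq r (Set.Ioc_subset_Icc_self hr), Real.norm_eq_abs]]
      rw [← ENNReal.ofReal_le_iff_le_toReal hJtop, ofReal_integral_norm_eq_lintegral_enorm hint]
      calc ∫⁻ r in Set.Ioc s t, ‖u r y‖ₑ ≤ ∫⁻ r in Set.Ioc s t, ⨆ x ∈ ω, ‖u r x‖ₑ :=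
            lintegral_mono fun r => le_iSup₂ (f := fun x (_ : x ∈ ω) => ‖u r x‖ₑ) y hyω
        _ ≤ ∫⁻ r in Set.Ioc 0 T, ⨆ x ∈ ω, ‖u r x‖ₑ :=
            lintegral_mono_set (Set.Ioc_subset_Ioc hs.le htT)
        _ = J := by rw [hJ, restrict_Ioo_eq_restrict_Ioc])
    ENNReal.toReal_nonneg
  rw [eLpNorm_exponent_top]
  have hfin : ENNReal.ofReal C * J = ENNReal.ofReal (C * J.toReal) := by
    rw [ENNReal.ofReal_mul hC.le, ENNReal.ofReal_toReal hJtop]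
  rw [hfin]
  refine eLpNormEssSup_le_of_ae_bound ?_
  filter_upwards [ae_restrict_mem (isOpen_openUnitCube n).measurableSet] with x hx
  rw [hu.eq_heatSeries hT ⟨hT, le_rfl⟩ hx]
  exact hbound x.ofLp
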